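/- Let $\mathbb F_{p^m}$ be a finite field, $R=\mathbb F_{p^m}+u\mathbb F_{p^m}$ with $u^2=0$, let $\Theta$ be a ring automorphism of $R$ of order $2$, $\theta$ its restriction to $\mathbb F_{p^m}$, $\lambda\in\{1,-1\}$, and $n\ge 1$ a multiple of the order of $\Theta$. Let $R[x;\Theta]$ be the skew polynomial ring with $xa=\Theta(a)x$; it contains $\mathbb F_{p^m}[x;\theta]$, the skew polynomials with all coefficients in $\mathbb F_{p^m}$. In its localization at the powers of $x$ put $\varphi(\sum a_ix^i)=\sum x^{-i}a_i$, and put $\phi(\sum a_ix^i)=\sum\Theta(a_i)x^i$ on $R[x;\Theta]$. If $g$ is a monic right divisor of $f$, then $\frac fg$ denotes the $q$ with $f=qg$. For $f\in\mathbb F_{p^m}[x;\theta]$ let $\overleftarrow{f}^{\,u}\in\mathbb F_{p^m}[x;\theta]$ be the skew polynomial with $fu=u\overleftarrow{f}^{\,u}$. Elements of $R[x;\Theta]/\langle x^n-\lambda\rangle$ are identified with skew polynomials of degree less than $n$, and with their coefficient vectors in $R^n$; generators written below are read modulo $x^n-\lambda$. The Hermitian dual of $C$ is $C^{\perp_H}=\{v\in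 R^n\mid\sum_{i=0}^{n-1}v_i\Theta(c_i)=0\text{ for all }c\in C\}$. Let $C$ be a left ideal of $R[x;\Theta]/\langle x^n-\lambda\rangle$, and let $A$ be the set of nonzero skew polynomials of minimal degree in $C$. Below, $g_0,g_1,f_0,f_1\in\mathbb F_{p^m}[x;\theta]$. We say that $C$ is * of type LI-1 with generator $g_0+ug_1$, if either $C=0$ and $g_0+ug_1=x^n-\lambda$, or $g_0+ug_1$ is monic and belongs to $A$; * of type LI-2 with generator $ug_1$, if $C$ contains no monic skew polynomial and $ug_1\in A$ has leading coefficient $u$; * of type LI-3 with generators $ug_1,\ f_0+uf_1$, if $A$ contains no monic skew polynomial, $ug_1\in A$ has leading coefficient $u$, $f_0+uf_1$ is a monic skew polynomial of minimal degree among the monic ones in $C$, and $\deg f_1<\deg g_1$ (where $\deg 0=-\infty$). Then $C$ is of one of these types with some such generators, these generate $C$, and $C^{\perp_H}$ is again a left ideal of $R[x;\Theta]/\langle x^n-\lambda\rangle$, determined as follows (all the quotients exist, and all the displayed generators lie in $R[x;\Theta]$). 1. If $C=\langle g_0+ug_1\rangle$ is of type LI-1, then $C^{\perp_H}=\left\langle\phi\!\left(x^{n-\deg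 g_0}\varphi\!\left(\frac{x^n-\lambda}{g_0+ug_1}\right)\right)\right\rangle$. 2. If $C=\langle ug_1\rangle$ is of type LI-2, then $C^{\perp_H}=\left\langle u,\ \phi\!\left(x^{n-\deg g_1}\varphi\!\left(\frac{x^n-\lambda}{g_1}\right)\right)\right\rangle$. 3. If $C=\langle ug_1,\,f_0+uf_1\rangle$ is of type LI-3, then there is $m\in\mathbb F_{p^m}[x;\theta]$ with $m\,g_1=\overleftarrow{\left(\frac{x^n-\lambda}{f_0}\right)}^{u}f_1$ and $$C^{\perp_H}=\left\langle\phi\!\left(x^{n-\deg f_0}\varphi\!\left(\frac{x^n-\lambda}{f_0}\,u\right)\right),\ \phi\!\left(x^{n-\deg g_1}\varphi\!\left(\frac{x^n-\lambda}{g_1}-um\right)\right)\right\rangle.$$ -/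

import Mathlib

open scoped DualNumber

noncomputable section

namespace SkewConstacyclic

section General

variable {R : Type*} [CommRing R]

/-- A copy of the ring `R` on which the powers of `x` act through the powers of the
automorphism `Θ`. It only serves to tell Mathlib's skew polynomials which automorphism to use. -/
def Coeff (_Θ : RingAut R) : Type _ := R

instance (Θ : RingAut R) : CommRing (Coeff Θ) := inferInstanceAs (CommRing R)

/-- The identity map of `R`, as an isomorphism from `R` to its copy. -/
def toCoeff (Θ : RingAut R) : R ≃+* Coeff Θ := RingEquiv.refl R

/-- The `k`-th power of `x` acts on coefficients as `Θ ^ k`, for natural `k`. -/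
instance (Θ : RingAut R) : MulSemiringAction (Multiplicative ℕ) (Coeff Θ) where
  smul k a := toCoeff Θ ((Θ ^ k.toAdd) ((toCoeff Θ).symm a))
  one_smul _ := rfl
  mul_smul k l a := congrArg (fun ψ : RingAut R => ψ a) (pow_add Θ k.toAdd l.toAdd)
  smul_zero k := map_zero (Θ ^ k.toAdd)
  smul_add k := map_add (Θ ^ k.toAdd)
  smul_one k := map_one (Θ ^ k.toAdd)
  smul_mul k := map_mul (Θ ^ k.toAdd)

/-- The `k`-th power of `x` acts on coefficients as `Θ ^ k`, for integral `k`. -/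
instance (Θ : RingAut R) : MulSemiringAction (Multiplicative ℤ) (Coeff Θ) where
  smul k a := toCoeff Θ ((Θ ^ k.toAdd) ((toCoeff Θ).symm a))
  one_smul _ := rfl
  mul_smul k l a := congrArg (fun ψ : RingAut R => ψ a) (zpow_add Θ k.toAdd l.toAdd)
  smul_zero k := map_zero (Θ ^ k.toAdd)
  smul_add k := map_add (Θ ^ k.toAdd)
  smul_one k := map_one (Θ ^ k.toAdd)
  smul_mul k := map_mul (Θ ^ k.toAdd)

/-- The skew polynomial ring `R[x;Θ]`, in which `x * a = Θ a * x`. -/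
abbrev SkewPoly (Θ : RingAut R) : Type _ := SkewPolynomial (Coeff Θ)

/-- The localization of `R[x;Θ]` at the powers of `x`, that is the skew Laurent polynomial ring
`R[x, x⁻¹; Θ]`, in which `a * x⁻¹ = x⁻¹ * Θ a`. -/
abbrev SkewLaurent (Θ : RingAut R) : Type _ := SkewMonoidAlgebra (Coeff Θ) (Multiplicative ℤ)

/-- The constant skew polynomial `a`. -/
def const (Θ : RingAut R) (a : R) : SkewPoly Θ := SkewPolynomial.C (toCoeff Θ a)

/-- The power `x ^ k` in the skew Laurent polynomial ring, for an integer `k`. -/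
def xpow (Θ : RingAut R) (k : ℤ) : SkewLaurent Θ :=
  SkewMonoidAlgebra.single (Multiplicative.ofAdd k) 1

/-- The inclusion of the skew polynomials into the skew Laurent polynomials. -/
def toLaurent {Θ : RingAut R} (f : SkewPoly Θ) : SkewLaurent Θ :=
  f.sum fun i a => SkewMonoidAlgebra.single (Multiplicative.ofAdd (i : ℤ)) a

/-- The ring anti-monomorphism `∑ aᵢ xⁱ ↦ ∑ x⁻ⁱ aᵢ`. -/
def antiHom {Θ : RingAut R} (f : SkewPoly Θ) : SkewLaurent Θ :=
  f.sum fun i a => xpow Θ (-(i : ℤ)) * SkewMonoidAlgebra.single 1 a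

/-- The coefficientwise automorphism `∑ aᵢ xⁱ ↦ ∑ Θ(aᵢ) xⁱ`. -/
def twist {Θ : RingAut R} (f : SkewPoly Θ) : SkewPoly Θ :=
  f.sum fun i a => SkewPolynomial.monomial i (toCoeff Θ (Θ ((toCoeff Θ).symm a)))

/-- The degree of a skew polynomial, with value `⊥` at `0`. -/
def degree {Θ : RingAut R} (f : SkewPoly Θ) : WithBot ℕ := f.support.max

/-- The degree of a skew polynomial as a natural number, with value `0` at `0`. -/
def natDegree {Θ : RingAut R} (f : SkewPoly Θ) : ℕ := (degree f).unbotD 0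

/-- The leading coefficient of a skew polynomial. -/
def leadingCoeff {Θ : RingAut R} (f : SkewPoly Θ) : R := (toCoeff Θ).symm (f.coeff (natDegree f))

/-- A skew polynomial is monic if its leading coefficient is `1`. -/
def IsMonic {Θ : RingAut R} (f : SkewPoly Θ) : Prop := leadingCoeff f = 1

/-- The skew polynomial `x ^ n - lam`. -/
def modulus (Θ : RingAut R) (n : ℕ) (lam : R) : SkewPoly Θ := SkewPolynomial.X ^ n - const Θ lam

/-- The quotient ring of `R[x;Θ]` by the two-sided ideal generated by `x ^ n - lam`. -/
abbrev SkewQuot (Θ : RingAut R) (n : ℕ) (lam : R) : Type _ :=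
  (TwoSidedIdeal.span {modulus Θ n lam}).ringCon.Quotient

/-- The quotient map. -/
def mk (Θ : RingAut R) (n : ℕ) (lam : R) : SkewPoly Θ →+* SkewQuot Θ n lam :=
  (TwoSidedIdeal.span {modulus Θ n lam}).ringCon.mk'

/-- The skew polynomial `v₀ + v₁ x + ⋯ + vₙ₋₁ xⁿ⁻¹` with coefficient vector `v`. -/
def ofVec (Θ : RingAut R) {n : ℕ} (v : Fin n → R) : SkewPoly Θ :=
  ∑ i : Fin n, SkewPolynomial.monomial (i : ℕ) (toCoeff Θ (v i))

/-- The code of length `n` whose skew polynomial representation is the left ideal `C`. -/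
def code {Θ : RingAut R} {n : ℕ} {lam : R} (C : Ideal (SkewQuot Θ n lam)) : Set (Fin n → R) :=
  {v | mk Θ n lam (ofVec Θ v) ∈ C}

/-- The Hermitian inner product. -/
def hermitianInner (Θ : RingAut R) {n : ℕ} (v w : Fin n → R) : R := ∑ i, v i * Θ (w i)

/-- The Hermitian dual of a code. -/
def hermitianDual (Θ : RingAut R) {n : ℕ} (S : Set (Fin n → R)) : Set (Fin n → R) :=
  {v | ∀ c ∈ S, hermitianInner Θ v c = 0}

/-- The skew polynomials in `C`: elements of the quotient are identified with their unique
representatives of degree less than `n`. -/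
def reps {Θ : RingAut R} {n : ℕ} {lam : R} (C : Ideal (SkewQuot Θ n lam)) : Set (SkewPoly Θ) :=
  {f | degree f < n ∧ mk Θ n lam f ∈ C}

/-- The set of all nonzero skew polynomials of minimal degree in `C`. -/
def minReps {Θ : RingAut R} {n : ℕ} {lam : R} (C : Ideal (SkewQuot Θ n lam)) :
    Set (SkewPoly Θ) :=
  {f | f ∈ reps C ∧ f ≠ 0 ∧ ∀ g ∈ reps C, g ≠ 0 → degree f ≤ degree g}

end General

section DualNumbers

variable {F : Type*} [Field F]

/-- The element `u` of `F + uF`, as a constant skew polynomial. -/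
def u (Θ : RingAut F[ε]) : SkewPoly Θ := const Θ DualNumber.eps

/-- `f` belongs to `F[x;θ]`, that is all its coefficients lie in the subfield `F` of `F + uF`.
Every automorphism `Θ` of `F + uF`, for a finite field `F`, maps `F` to `F`; its restriction
is `θ`. -/
def OverField {Θ : RingAut F[ε]} (f : SkewPoly Θ) : Prop :=
  ∀ i, ((toCoeff Θ).symm (f.coeff i)).snd = 0

variable {Θ : RingAut F[ε]} {n : ℕ} {lam : F[ε]}

/-- `C` is of type LI-1 with generator `g₀ + u g₁`: either `C` is zero, represented by
`x ^ n - lam`, or `g₀ + u g₁` is a monic skew polynomial of minimal degree in `C`. -/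
structure IsLI1 (C : Ideal (SkewQuot Θ n lam)) (g₀ g₁ : SkewPoly Θ) : Prop where
  overField_g₀ : OverField g₀
  overField_g₁ : OverField g₁
  minimal : (C = ⊥ ∧ g₀ + u Θ * g₁ = modulus Θ n lam) ∨
    (g₀ + u Θ * g₁ ∈ minReps C ∧ IsMonic (g₀ + u Θ * g₁))

/-- `C` is of type LI-2 with generator `u g₁`: there are no monic skew polynomials in `C`, and
`u g₁` is the skew polynomial of minimal degree with leading coefficient `u` in `C`. -/
structure IsLI2 (C : Ideal (SkewQuot Θ n lam)) (g₁ : SkewPoly Θ) : Prop where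
  overField_g₁ : OverField g₁
  not_monic : ∀ f ∈ reps C, ¬ IsMonic f
  minimal : u Θ * g₁ ∈ minReps C
  leadingCoeff_eq : leadingCoeff (u Θ * g₁) = DualNumber.eps

/-- `C` is of type LI-3 with generators `u g₁` and `f₀ + u f₁`: there are monic skew polynomials
in `C`, but none among the nonzero ones of minimal degree; `u g₁` is of minimal degree with
leading coefficient `u`; and `f₀ + u f₁` is a monic skew polynomial of minimal degree in `C`
with `deg f₁ < deg g₁`. -/
structure IsLI3 (C : Ideal (SkewQuot Θ n lam)) (g₁ f₀ f₁ : SkewPoly Θ) : Prop where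
  overField_g₁ : OverField g₁
  overField_f₀ : OverField f₀
  overField_f₁ : OverField f₁
  not_monic : ∀ f ∈ minReps C, ¬ IsMonic f
  minimal : u Θ * g₁ ∈ minReps C
  leadingCoeff_eq : leadingCoeff (u Θ * g₁) = DualNumber.eps
  mem : f₀ + u Θ * f₁ ∈ reps C
  monic : IsMonic (f₀ + u Θ * f₁)
  minimal_monic : ∀ f ∈ reps C, IsMonic f → degree (f₀ + u Θ * f₁) ≤ degree f
  degree_lt : degree f₁ < degree g₁

end DualNumbers

end SkewConstacyclic

end

open scoped DualNumber

open SkewConstacyclic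

open scoped DualNumber

noncomputable section

namespace SkewConstacyclic

/-! ### Coefficients, degrees and right division in `R[x;Θ]`. -/

section Coefficients

variable {R : Type*} [CommRing R] {Θ : RingAut R}

/-! Write π for `modulus Θ n lam`. Since Θ² = Θⁿ = 1, λ² = 1 and Θ fixes λ (`Admissible`), π is
central and x becomes a unit of the quotient ring. The quotient then carries an involutive
anti-automorphism `Admissible.bar`, x ↦ x⁻¹ and a ↦ Θ(a), and the Hermitian product of v and w is
the constant coefficient of v · bar(w) (`Admissible.trace_mul_bar`). This pairing is nondegenerate
and C is a left ideal, so the dual consists of the w whose image bar(w) is killed by C from the left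
(`Admissible.hermitianDual_code`). If a and b generate the right annihilator of C as a right ideal,
then bar(a) and bar(b) generate the dual as a left ideal. The displayed generators are unit
multiples of these: twisting the reciprocal of h gives xᵏ bar(h) (`Admissible.mk_twist_reciprocal`),
and u is a unit multiple of bar(u).

It remains to compute right annihilators. The minimal-degree conditions and right division by monic
polynomials give the generators of C and the factorizations of π, e.g. h g = π; centrality yields g
h = π as well. Cancelling g then shows that a monic g has annihilator h · S, where S is the quotient
ring. For u g₁ one works modulo u, whose two-sided ideal has square zero, and gets h · S + u · S.
For the third type, with π = hf · f₀ = hg · g₁, the correction m makes the cross terms in (f₀ + u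
f₁)(hg − u m) cancel, so that hf · u and hg − u m generate the annihilator
(`Admissible.dualIdeal_of_pair`). -/

/-- The monomial `a * x ^ i`. -/
def mono (Θ : RingAut R) (i : ℕ) (a : R) : SkewPoly Θ := SkewPolynomial.monomial i (toCoeff Θ a)

/-- The coefficient of `x ^ i`, as an element of `R`. -/
def cf (f : SkewPoly Θ) (i : ℕ) : R := (toCoeff Θ).symm (f.coeff i)

lemma ext_cf {f g : SkewPoly Θ} (h : ∀ i, cf f i = cf g i) : f = g := by
  refine SkewMonoidAlgebra.ext fun i => ?_
  exact (toCoeff Θ).symm.injective (h i.toAdd)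

@[simp] lemma cf_zero (i : ℕ) : cf (0 : SkewPoly Θ) i = 0 := rfl

@[simp] lemma cf_add (f g : SkewPoly Θ) (i : ℕ) : cf (f + g) i = cf f i + cf g i := by
  simp only [cf, SkewPolynomial.coeff_add, map_add]

@[simp] lemma cf_neg (f : SkewPoly Θ) (i : ℕ) : cf (-f) i = -cf f i := by
  simp only [cf, SkewPolynomial.coeff_neg, map_neg]

@[simp] lemma cf_sub (f g : SkewPoly Θ) (i : ℕ) : cf (f - g) i = cf f i - cf g i := by
  simp only [cf, SkewPolynomial.coeff_sub, map_sub]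

/-- The coefficient of `x ^ i`, as an additive map. -/
def cfHom (Θ : RingAut R) (i : ℕ) : SkewPoly Θ →+ R where
  toFun f := cf f i
  map_zero' := cf_zero i
  map_add' f g := cf_add f g i

lemma cf_sum {ι : Type*} (s : Finset ι) (f : ι → SkewPoly Θ) (i : ℕ) :
    cf (∑ j ∈ s, f j) i = ∑ j ∈ s, cf (f j) i :=
  map_sum (cfHom Θ i) f s

lemma cf_mono (i j : ℕ) (a : R) : cf (mono Θ i a) j = if i = j then a else 0 := by
  simp only [cf, mono, SkewPolynomial.coeff_monomial]
  split_ifs <;> simp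

lemma mono_add (i : ℕ) (a b : R) : mono Θ i (a + b) = mono Θ i a + mono Θ i b := by
  simp only [mono, map_add]

@[simp] lemma mono_zero (i : ℕ) : mono Θ i 0 = 0 := by
  simp only [mono, map_zero]

@[simp] lemma mono_zero_one : mono Θ 0 1 = 1 := rfl

lemma const_eq_mono (a : R) : const Θ a = mono Θ 0 a := rfl

lemma mono_mul_mono (i j : ℕ) (a b : R) :
    mono Θ i a * mono Θ j b = mono Θ (i + j) (a * (Θ ^ i) b) := by
  simp only [mono, SkewPolynomial.monomial_mul_monomial, SkewPolynomial.φ_iterate_apply]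
  rfl

lemma X_pow_eq_mono (n : ℕ) : (SkewPolynomial.X : SkewPoly Θ) ^ n = mono Θ n 1 := by
  rw [← SkewPolynomial.monomial_one_right_eq_X_pow]
  simp [mono]

@[elab_as_elim]
lemma poly_induction {P : SkewPoly Θ → Prop} (f : SkewPoly Θ)
    (add : ∀ f g, P f → P g → P (f + g)) (mono : ∀ i a, P (mono Θ i a)) : P f := by
  induction f using SkewPolynomial.induction with
  | h0 => simpa using mono 0 0
  | ha n r q _ _ hq => exact add _ _ (mono n ((toCoeff Θ).symm r)) hq

lemma cf_mono_mul (i : ℕ) (a : R) (g : SkewPoly Θ) (k : ℕ) :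
    cf (mono Θ i a * g) k = if i ≤ k then a * (Θ ^ i) (cf g (k - i)) else 0 := by
  induction g using poly_induction with
  | add f g hf hg =>
    rw [mul_add, cf_add, hf, hg]
    split_ifs <;> simp [mul_add]
  | mono j b =>
    rw [mono_mul_mono, cf_mono, cf_mono]
    by_cases h : i + j = k
    · rw [if_pos h, if_pos (by omega), if_pos (by omega)]
    · rw [if_neg h]
      split_ifs
      · omega
      · simp
      · rfl

lemma cf_mul (f g : SkewPoly Θ) (k : ℕ) :
    cf (f * g) k = ∑ i ∈ Finset.range (k + 1), cf f i * (Θ ^ i) (cf g (k - i)) := by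
  induction f using poly_induction with
  | add f g hf hg =>
    rw [add_mul, cf_add, hf, hg, ← Finset.sum_add_distrib]
    simp [add_mul]
  | mono j b =>
    rw [cf_mono_mul]
    simp [cf_mono, ite_mul]

@[simp] lemma cf_const_mul (a : R) (g : SkewPoly Θ) (k : ℕ) :
    cf (const Θ a * g) k = a * cf g k := by
  rw [const_eq_mono, cf_mono_mul]; simp

lemma cf_mul_mono (f : SkewPoly Θ) (j : ℕ) (a : R) (k : ℕ) :
    cf (f * mono Θ j a) k = if j ≤ k then cf f (k - j) * (Θ ^ (k - j)) a else 0 := by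
  induction f using poly_induction with
  | add f g hf hg =>
    rw [add_mul, cf_add, hf, hg]
    split_ifs <;> simp [add_mul]
  | mono i b =>
    rw [mono_mul_mono, cf_mono, cf_mono]
    by_cases h : i + j = k
    · rw [if_pos h, if_pos (by omega), if_pos (by omega), show k - j = i by omega]
    · rw [if_neg h]
      split_ifs
      · omega
      · simp
      · rfl

lemma cf_mul_const (f : SkewPoly Θ) (a : R) (k : ℕ) :
    cf (f * const Θ a) k = cf f k * (Θ ^ k) a := by
  rw [const_eq_mono, cf_mul_mono]; simp

/-- All coefficients of `f` from the `d`-th on vanish. -/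
def DegLT (f : SkewPoly Θ) (d : ℕ) : Prop := ∀ i, d ≤ i → cf f i = 0

lemma DegLT.mono {f : SkewPoly Θ} {d e : ℕ} (h : DegLT f d) (hde : d ≤ e) : DegLT f e :=
  fun i hi => h i (hde.trans hi)

lemma DegLT.add {f g : SkewPoly Θ} {d : ℕ} (hf : DegLT f d) (hg : DegLT g d) :
    DegLT (f + g) d := fun i hi => by rw [cf_add, hf i hi, hg i hi, add_zero]

lemma DegLT.sub {f g : SkewPoly Θ} {d : ℕ} (hf : DegLT f d) (hg : DegLT g d) :
    DegLT (f - g) d := fun i hi => by rw [cf_sub, hf i hi, hg i hi, sub_zero]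

lemma degLT_zero (d : ℕ) : DegLT (0 : SkewPoly Θ) d := fun _ _ => rfl

lemma DegLT.eq_zero {f : SkewPoly Θ} (h : DegLT f 0) : f = 0 :=
  ext_cf fun i => h i i.zero_le

lemma degLT_mono (i : ℕ) (a : R) : DegLT (SkewConstacyclic.mono Θ i a) (i + 1) := fun j hj => by
  rw [cf_mono, if_neg (by omega)]

lemma exists_degLT (f : SkewPoly Θ) : ∃ d, DegLT f d := by
  induction f using poly_induction with
  | add f g hf hg =>
    obtain ⟨d, hd⟩ := hf
    obtain ⟨e, he⟩ := hg
    exact ⟨max d e, (hd.mono (le_max_left _ _)).add (he.mono (le_max_right _ _))⟩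
  | mono i a => exact ⟨i + 1, degLT_mono i a⟩

lemma DegLT.mul {f g : SkewPoly Θ} {a b : ℕ} (hf : DegLT f (a + 1)) (hg : DegLT g b) :
    DegLT (f * g) (a + b) := by
  intro k hk
  rw [cf_mul]
  refine Finset.sum_eq_zero fun i _ => ?_
  by_cases h : a + 1 ≤ i
  · rw [hf i h, zero_mul]
  · rw [hg (k - i) (by omega), map_zero, mul_zero]

lemma DegLT.const_mul {g : SkewPoly Θ} {d : ℕ} (h : DegLT g d) (a : R) :
    DegLT (const Θ a * g) d := fun i hi => by rw [cf_const_mul, h i hi, mul_zero]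

lemma cf_mul_add {f g : SkewPoly Θ} {a b : ℕ} (hf : DegLT f (a + 1)) (hg : DegLT g (b + 1)) :
    cf (f * g) (a + b) = cf f a * (Θ ^ a) (cf g b) := by
  rw [cf_mul, Finset.sum_eq_single_of_mem a (by simp)]
  · rw [Nat.add_sub_cancel_left]
  · intro i _ hia
    by_cases h : a + 1 ≤ i
    · rw [hf i h, zero_mul]
    · rw [hg (a + b - i) (by omega), map_zero, mul_zero]

/-- The skew polynomial with the given coefficients below degree `d`. -/
def ofCf (Θ : RingAut R) (d : ℕ) (a : ℕ → R) : SkewPoly Θ := ∑ i ∈ Finset.range d, mono Θ i (a i)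

lemma cf_ofCf (d : ℕ) (a : ℕ → R) (i : ℕ) : cf (ofCf Θ d a) i = if i < d then a i else 0 := by
  simp [ofCf, cf_sum, cf_mono]

lemma DegLT.ofCf_cf {f : SkewPoly Θ} {d : ℕ} (h : DegLT f d) : ofCf Θ d (cf f) = f := by
  refine ext_cf fun i => ?_
  rw [cf_ofCf]
  split_ifs with hi
  · rfl
  · exact (h i (not_lt.1 hi)).symm

/-- `g` is monic of degree `d`. -/
structure MonicOf (g : SkewPoly Θ) (d : ℕ) : Prop where
  cf_eq : cf g d = 1
  degLT : DegLT g (d + 1)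

/-- Twisting fixes the leading coefficient 1 of `g`, so the top coefficient of `h` survives in the
product even though `R` may have zero divisors. -/
lemma MonicOf.degLT_of_mul {g h : SkewPoly Θ} {d N : ℕ} (hg : MonicOf g d)
    (hN : DegLT (h * g) (N + d)) : DegLT h N := by
  obtain ⟨M, hM⟩ := exists_degLT h
  induction M with
  | zero => exact hM.mono N.zero_le
  | succ M ih =>
    by_cases hMN : M + 1 ≤ N
    · exact hM.mono hMN
    · refine ih fun i hi => ?_
      obtain rfl | hi := hi.eq_or_lt
      · have := cf_mul_add hM hg.degLT
        rwa [hg.cf_eq, map_one, mul_one, hN _ (by omega), eq_comm] at this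
      · exact hM i hi

lemma MonicOf.eq_zero_of_mul {g h : SkewPoly Θ} {d : ℕ} (hg : MonicOf g d) (h0 : h * g = 0) :
    h = 0 :=
  (hg.degLT_of_mul (N := 0) (h0 ▸ degLT_zero _)).eq_zero

lemma MonicOf.cancel_right {g a b : SkewPoly Θ} {d : ℕ} (hg : MonicOf g d) (h : a * g = b * g) :
    a = b :=
  sub_eq_zero.1 <| hg.eq_zero_of_mul <| by rw [sub_mul, h, sub_self]

lemma MonicOf.eq_zero_of_mul_left {g h : SkewPoly Θ} {d : ℕ} (hg : MonicOf g d)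
    (h0 : g * h = 0) : h = 0 := by
  obtain ⟨M, hM⟩ := exists_degLT h
  induction M with
  | zero => exact hM.eq_zero
  | succ M ih =>
    refine ih fun i hi => ?_
    obtain rfl | hi := hi.eq_or_lt
    · have := cf_mul_add hg.degLT hM
      rwa [hg.cf_eq, one_mul, h0, cf_zero, eq_comm, EmbeddingLike.map_eq_zero_iff] at this
    · exact hM i hi

lemma MonicOf.cancel_left {g a b : SkewPoly Θ} {d : ℕ} (hg : MonicOf g d) (h : g * a = g * b) :
    a = b :=
  sub_eq_zero.1 <| hg.eq_zero_of_mul_left <| by rw [mul_sub, h, sub_self]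

/-- The skew polynomials with coefficients in a `Θ`-stable subring. -/
def polyOver (T : Subring R) (hT : ∀ a ∈ T, Θ a ∈ T) : Subring (SkewPoly Θ) where
  carrier := {f | ∀ i, cf f i ∈ T}
  zero_mem' _ := T.zero_mem
  one_mem' i := by
    rw [← mono_zero_one, cf_mono]
    split_ifs
    exacts [T.one_mem, T.zero_mem]
  add_mem' hf hg i := by
    rw [cf_add]
    exact T.add_mem (hf i) (hg i)
  neg_mem' hf i := by
    rw [cf_neg]
    exact T.neg_mem (hf i)
  mul_mem' {f g} hf hg k := by
    have key : ∀ (i : ℕ), ∀ a ∈ T, (Θ ^ i) a ∈ T := by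
      intro i
      induction i with
      | zero => exact fun a ha => ha
      | succ i ih =>
        intro a ha
        rw [pow_succ', RingAut.mul_apply]
        exact hT _ (ih a ha)
    rw [cf_mul]
    exact T.sum_mem fun i _ => T.mul_mem (hf i) (key i _ (hg _))

lemma mono_mem_polyOver {T : Subring R} {hT : ∀ a ∈ T, Θ a ∈ T} {a : R} (ha : a ∈ T) (i : ℕ) :
    mono Θ i a ∈ polyOver T hT := by
  intro j
  rw [cf_mono]
  split_ifs
  exacts [ha, T.zero_mem]

/-- Right division by a monic skew polynomial, over a `Θ`-stable subring. -/
lemma MonicOf.exists_div {g : SkewPoly Θ} {d : ℕ} (hg : MonicOf g d) {T : Subring R}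
    {hT : ∀ a ∈ T, Θ a ∈ T} (hgT : g ∈ polyOver T hT) {f : SkewPoly Θ} (hf : f ∈ polyOver T hT) :
    ∃ q ∈ polyOver T hT, ∃ r ∈ polyOver T hT, f = q * g + r ∧ DegLT r d := by
  obtain ⟨N, hN⟩ := exists_degLT f
  induction N generalizing f with
  | zero => exact ⟨0, zero_mem _, f, hf, by simp, hN.mono d.zero_le⟩
  | succ N ih =>
    by_cases hd : N + 1 ≤ d
    · exact ⟨0, zero_mem _, f, hf, by simp, hN.mono hd⟩
    -- Left multiplication of `g` by this monomial reproduces the coefficient of `f` at `N`;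
    -- subtracting the product lowers the degree bound.
    · have hm : mono Θ (N - d) (cf f N) ∈ polyOver T hT := mono_mem_polyOver (hf N) _
      have hND : N - d + d = N := by omega
      obtain ⟨q, hq, r, hr, h, hrd⟩ := ih (sub_mem hf (mul_mem hm hgT)) (by
        intro i hi
        rw [cf_sub]
        obtain rfl | hi := hi.eq_or_lt
        · have := cf_mul_add (degLT_mono (Θ := Θ) (N - d) (cf f N)) hg.degLT
          rw [hND, cf_mono, if_pos rfl, hg.cf_eq, map_one, mul_one] at this
          rw [this, sub_self]
        · rw [hN i hi, (degLT_mono (Θ := Θ) (N - d) (cf f N)).mul hg.degLT i (by omega), sub_zero])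
      refine ⟨q + mono Θ (N - d) (cf f N), add_mem hq hm, r, hr, ?_, hrd⟩
      rw [add_mul, add_right_comm, ← h, sub_add_cancel]

lemma MonicOf.exists_div' {g : SkewPoly Θ} {d : ℕ} (hg : MonicOf g d) (f : SkewPoly Θ) :
    ∃ q r, f = q * g + r ∧ DegLT r d := by
  obtain ⟨q, -, r, -, h⟩ := hg.exists_div (T := ⊤) (hT := fun _ _ => trivial)
    (fun _ => trivial) (f := f) (fun _ => trivial)
  exact ⟨q, r, h⟩

/-! ### Degrees -/

lemma mem_support_iff_cf {f : SkewPoly Θ} {i : ℕ} : i ∈ f.support ↔ cf f i ≠ 0 := by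
  rw [SkewPolynomial.mem_support_iff, cf, Ne, Ne, EmbeddingLike.map_eq_zero_iff]

lemma degree_lt_iff {f : SkewPoly Θ} {d : ℕ} : degree f < d ↔ DegLT f d := by
  rw [degree, Finset.max_eq_sup_withBot, Nat.cast_withBot, Finset.sup_lt_iff (WithBot.bot_lt_coe d)]
  simp only [mem_support_iff_cf, DegLT]
  refine forall_congr' fun i => ?_
  rw [WithBot.coe_lt_coe]
  constructor
  · intro h hi
    by_contra h0
    exact absurd (h h0) (not_lt.2 hi)
  · intro h h0
    by_contra hi
    exact h0 (h (not_lt.1 hi))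

lemma le_degree_of_cf {f : SkewPoly Θ} {i : ℕ} (h : cf f i ≠ 0) : (i : WithBot ℕ) ≤ degree f :=
  Finset.le_max (mem_support_iff_cf.2 h)

lemma degree_eq {f : SkewPoly Θ} {d : ℕ} (h : cf f d ≠ 0) (hd : DegLT f (d + 1)) :
    degree f = d := by
  refine le_antisymm ?_ (le_degree_of_cf h)
  have := degree_lt_iff.2 hd
  cases hf : degree f with
  | bot => exact bot_le
  | coe e =>
    rw [hf] at this
    simp only [Nat.cast_withBot, WithBot.coe_lt_coe, WithBot.coe_le_coe] at this ⊢
    omega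

lemma natDegree_eq {f : SkewPoly Θ} {d : ℕ} (h : cf f d ≠ 0) (hd : DegLT f (d + 1)) :
    natDegree f = d := by
  rw [natDegree, degree_eq h hd]; rfl

lemma exists_degree {f : SkewPoly Θ} (h : f ≠ 0) : ∃ d, cf f d ≠ 0 ∧ DegLT f (d + 1) := by
  classical
  obtain ⟨M, hM⟩ := exists_degLT f
  induction M with
  | zero => exact absurd hM.eq_zero h
  | succ M ih =>
    by_cases h0 : cf f M = 0
    · refine ih fun i hi => ?_
      obtain rfl | hi := hi.eq_or_lt
      exacts [h0, hM i hi]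
    · exact ⟨M, h0, hM⟩

lemma leadingCoeff_eq {f : SkewPoly Θ} {d : ℕ} (h : cf f d ≠ 0) (hd : DegLT f (d + 1)) :
    leadingCoeff f = cf f d := by
  rw [leadingCoeff, natDegree_eq h hd]; rfl

lemma MonicOf.ne_zero [Nontrivial R] {f : SkewPoly Θ} {d : ℕ} (h : MonicOf f d) : f ≠ 0 := by
  rintro rfl
  exact zero_ne_one (α := R) h.cf_eq

lemma MonicOf.cf_ne_zero [Nontrivial R] {f : SkewPoly Θ} {d : ℕ} (h : MonicOf f d) :
    cf f d ≠ 0 := by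
  rw [h.cf_eq]; exact one_ne_zero (α := R)

lemma MonicOf.isMonic [Nontrivial R] {f : SkewPoly Θ} {d : ℕ} (h : MonicOf f d) : IsMonic f := by
  rw [IsMonic, leadingCoeff_eq h.cf_ne_zero h.degLT, h.cf_eq]

lemma IsMonic.monicOf [Nontrivial R] {f : SkewPoly Θ} (h : IsMonic f) :
    MonicOf f (natDegree f) := by
  have h0 : f ≠ 0 := by
    rintro rfl
    exact zero_ne_one (α := R) h
  obtain ⟨d, hd, hd'⟩ := exists_degree h0
  rw [natDegree_eq hd hd']
  exact ⟨(leadingCoeff_eq hd hd').symm.trans h, hd'⟩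

lemma MonicOf.degree_eq [Nontrivial R] {f : SkewPoly Θ} {d : ℕ} (h : MonicOf f d) :
    degree f = d :=
  SkewConstacyclic.degree_eq h.cf_ne_zero h.degLT

lemma MonicOf.natDegree_eq [Nontrivial R] {f : SkewPoly Θ} {d : ℕ} (h : MonicOf f d) :
    natDegree f = d :=
  SkewConstacyclic.natDegree_eq h.cf_ne_zero h.degLT

end Coefficients

/-! ### Reciprocal polynomials in the skew Laurent ring. -/

section Laurent

variable {R : Type*} [CommRing R] {Θ : RingAut R}

lemma toLaurent_add (f g : SkewPoly Θ) : toLaurent (f + g) = toLaurent f + toLaurent g :=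
  SkewPolynomial.sum_add_index _ _ _ (fun _ => SkewMonoidAlgebra.single_zero _)
    fun _ _ _ => SkewMonoidAlgebra.single_add _ _ _

lemma toLaurent_mono (i : ℕ) (a : R) :
    toLaurent (mono Θ i a) =
      SkewMonoidAlgebra.single (Multiplicative.ofAdd (i : ℤ)) (toCoeff Θ a) :=
  SkewPolynomial.sum_monomial_index (SkewMonoidAlgebra.single_zero _)

lemma antiHom_add (f g : SkewPoly Θ) : antiHom (f + g) = antiHom f + antiHom g := by
  refine SkewPolynomial.sum_add_index _ _ _ (fun _ => ?_) fun _ _ _ => ?_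
  · rw [SkewMonoidAlgebra.single_zero, mul_zero]
  · rw [SkewMonoidAlgebra.single_add, mul_add]

lemma antiHom_mono (i : ℕ) (a : R) :
    antiHom (mono Θ i a) =
      xpow Θ (-(i : ℤ)) * SkewMonoidAlgebra.single 1 (toCoeff Θ a) := by
  refine SkewPolynomial.sum_monomial_index ?_
  rw [SkewMonoidAlgebra.single_zero, mul_zero]

lemma twist_add (f g : SkewPoly Θ) : twist (f + g) = twist f + twist g := by
  refine SkewPolynomial.sum_add_index _ _ _ (fun _ => ?_) fun _ _ _ => ?_
  · simp
  · simp

lemma twist_mono (i : ℕ) (a : R) : twist (mono Θ i a) = mono Θ i (Θ a) := by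
  refine SkewPolynomial.sum_monomial_index ?_
  simp

/-- `toLaurent` as an additive map. -/
def toLaurentHom (Θ : RingAut R) : SkewPoly Θ →+ SkewLaurent Θ :=
  AddMonoidHom.mk' toLaurent toLaurent_add

/-- `antiHom` as an additive map. -/
def antiHomHom (Θ : RingAut R) : SkewPoly Θ →+ SkewLaurent Θ :=
  AddMonoidHom.mk' antiHom antiHom_add

/-- `twist` as an additive map. -/
def twistHom (Θ : RingAut R) : SkewPoly Θ →+ SkewPoly Θ :=
  AddMonoidHom.mk' twist twist_add

/-- Moving `a` to the left of the power x^(k−i) twists it by `Θ ^ (k - i)`. -/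
lemma toLaurent_mono_reciprocal {k i : ℕ} (h : i ≤ k) (a : R) :
    toLaurent (mono Θ (k - i) ((Θ ^ (k - i)) a)) = xpow Θ k * antiHom (mono Θ i a) := by
  rw [toLaurent_mono, antiHom_mono, xpow, xpow, SkewMonoidAlgebra.single_mul_single,
    SkewMonoidAlgebra.single_mul_single, smul_mul', smul_smul, smul_one, one_mul, one_mul,
    mul_one, ← ofAdd_add, Nat.cast_sub h, ← sub_eq_add_neg]
  congr 1
  change _ = toCoeff Θ ((Θ ^ ((k : ℤ) - i)) a)
  rw [← Nat.cast_sub h, zpow_natCast]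

/-- The reciprocal `x ^ k * φ h` of a skew polynomial `h` of degree at most `k`. -/
def reciprocal (k : ℕ) (h : SkewPoly Θ) : SkewPoly Θ :=
  ∑ i ∈ Finset.range (k + 1), mono Θ (k - i) ((Θ ^ (k - i)) (cf h i))

lemma toLaurent_reciprocal {k : ℕ} {h : SkewPoly Θ} (hk : DegLT h (k + 1)) :
    toLaurent (reciprocal k h) = xpow Θ k * antiHom h := by
  conv_rhs => rw [← hk.ofCf_cf]
  change toLaurentHom Θ _ = xpow Θ k * antiHomHom Θ _
  rw [reciprocal, ofCf, map_sum, map_sum, Finset.mul_sum]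
  exact Finset.sum_congr rfl fun i hi =>
    toLaurent_mono_reciprocal (Nat.lt_succ_iff.1 (Finset.mem_range.1 hi)) _

end Laurent

/-! ### The quotient ring, its involution and the Hermitian form. -/

section Quotient

variable {R : Type*} [CommRing R] {Θ : RingAut R} {n : ℕ} {lam : R}

/-- The assumptions on `Θ`, `n` and `lam` under which `x ^ n - lam` is central and the
Hermitian inner product is sesquilinear with respect to an involution. -/
structure Admissible (Θ : RingAut R) (n : ℕ) (lam : R) : Prop where
  intro ::
  pos : 0 < n
  sq_eq : Θ ^ 2 = 1
  pow_eq : Θ ^ n = 1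
  lam_mul_self : lam * lam = 1
  map_lam : Θ lam = lam

lemma modulus_eq (Θ : RingAut R) (n : ℕ) (lam : R) :
    modulus Θ n lam = mono Θ n 1 - mono Θ 0 lam := by
  rw [modulus, X_pow_eq_mono, const_eq_mono]

lemma Admissible.pow_map_lam (H : Admissible Θ n lam) (k : ℕ) : (Θ ^ k) lam = lam := by
  induction k with
  | zero => rfl
  | succ k ih => rw [pow_succ, RingAut.mul_apply, H.map_lam, ih]

lemma Admissible.monicOf_modulus (H : Admissible Θ n lam) : MonicOf (modulus Θ n lam) n := by
  have := H.pos
  rw [modulus_eq]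
  constructor
  · rw [cf_sub, cf_mono, cf_mono, if_pos rfl, if_neg (by omega), sub_zero]
  · exact (degLT_mono _ _).sub ((degLT_mono _ _).mono (by omega))

/-- The power xⁿ commutes with coefficients because `Θ ^ n = 1`, and `lam` commutes with x because Θ
fixes it. -/
lemma Admissible.modulus_comm (H : Admissible Θ n lam) (f : SkewPoly Θ) :
    modulus Θ n lam * f = f * modulus Θ n lam := by
  rw [modulus_eq, sub_mul, mul_sub]
  refine ext_cf fun i => ?_
  rw [cf_sub, cf_sub, cf_mono_mul, cf_mono_mul, cf_mul_mono, cf_mul_mono, H.pow_eq,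
    H.pow_map_lam]
  simp [mul_comm]

lemma mk_surjective (Θ : RingAut R) (n : ℕ) (lam : R) : Function.Surjective (mk Θ n lam) :=
  RingCon.mk'_surjective _

/-- Centrality of the modulus collapses the two-sided ideal to plain multiples. -/
lemma Admissible.mk_eq_zero (H : Admissible Θ n lam) {f : SkewPoly Θ} :
    mk Θ n lam f = 0 ↔ ∃ s, f = modulus Θ n lam * s := by
  have h1 : mk Θ n lam f = 0 ↔ f ∈ TwoSidedIdeal.span {modulus Θ n lam} := by
    rw [TwoSidedIdeal.mem_iff]
    exact RingCon.eq _
  rw [h1]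
  clear h1
  constructor
  · intro h
    induction h using TwoSidedIdeal.span_induction with
    | mem x hx => exact ⟨1, by rw [Set.mem_singleton_iff.1 hx, mul_one]⟩
    | zero => exact ⟨0, (mul_zero _).symm⟩
    | add x y _ _ hx hy =>
      obtain ⟨s, rfl⟩ := hx
      obtain ⟨t, rfl⟩ := hy
      exact ⟨s + t, (mul_add _ _ _).symm⟩
    | neg x _ hx =>
      obtain ⟨s, rfl⟩ := hx
      exact ⟨-s, (mul_neg _ _).symm⟩
    | left_absorb a x _ hx =>
      obtain ⟨s, rfl⟩ := hx
      exact ⟨a * s, by rw [← mul_assoc, ← H.modulus_comm, mul_assoc]⟩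
    | right_absorb b x _ hx =>
      obtain ⟨s, rfl⟩ := hx
      exact ⟨s * b, mul_assoc _ _ _⟩
  · rintro ⟨s, rfl⟩
    exact TwoSidedIdeal.mul_mem_right _ _ _ (TwoSidedIdeal.subset_span rfl)

lemma Admissible.mk_modulus (H : Admissible Θ n lam) : mk Θ n lam (modulus Θ n lam) = 0 :=
  H.mk_eq_zero.2 ⟨1, (mul_one _).symm⟩

lemma Admissible.mk_mono_self (H : Admissible Θ n lam) :
    mk Θ n lam (mono Θ n 1) = mk Θ n lam (const Θ lam) := by
  rw [← sub_eq_zero, ← map_sub, const_eq_mono]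
  exact (congrArg (mk Θ n lam) (modulus_eq Θ n lam)).symm.trans H.mk_modulus

/-- The constants of the quotient ring. -/
def qconst (Θ : RingAut R) (n : ℕ) (lam : R) : R →+* SkewQuot Θ n lam :=
  (mk Θ n lam).comp (SkewPolynomial.CRingHom.comp (toCoeff Θ : R →+* Coeff Θ))

lemma qconst_apply (a : R) : qconst Θ n lam a = mk Θ n lam (const Θ a) := rfl

/-- In the quotient xⁿ = λ and λ² = 1, so λxⁿ⁻¹ inverts x. -/
lemma Admissible.x_mul_inv (H : Admissible Θ n lam) :
    mk Θ n lam (mono Θ 1 1) * mk Θ n lam (mono Θ (n - 1) lam) = 1 := by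
  have := H.pos
  rw [← map_mul, mono_mul_mono, pow_one, H.map_lam, one_mul, Nat.add_sub_cancel' (by omega)]
  have h : mono Θ n lam = mono Θ 0 lam * mono Θ n 1 := by simp [mono_mul_mono]
  rw [h, map_mul, H.mk_mono_self, ← map_mul, const_eq_mono, mono_mul_mono, pow_zero,
    RingAut.one_apply, H.lam_mul_self, add_zero, mono_zero_one, map_one]

lemma Admissible.inv_mul_x (H : Admissible Θ n lam) :
    mk Θ n lam (mono Θ (n - 1) lam) * mk Θ n lam (mono Θ 1 1) = 1 := by
  have := H.pos
  rw [← map_mul, mono_mul_mono, map_one, mul_one, Nat.sub_add_cancel (by omega)]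
  have h : mono Θ n lam = mono Θ 0 lam * mono Θ n 1 := by simp [mono_mul_mono]
  rw [h, map_mul, H.mk_mono_self, ← map_mul, const_eq_mono, mono_mul_mono, pow_zero,
    RingAut.one_apply, H.lam_mul_self, add_zero, mono_zero_one, map_one]

/-- The variable as a unit of the quotient ring. -/
def Admissible.x (H : Admissible Θ n lam) : (SkewQuot Θ n lam)ˣ where
  val := mk Θ n lam (mono Θ 1 1)
  inv := mk Θ n lam (mono Θ (n - 1) lam)
  val_inv := H.x_mul_inv
  inv_val := H.inv_mul_x

lemma Admissible.x_pow (H : Admissible Θ n lam) (i : ℕ) :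
    (H.x : SkewQuot Θ n lam) ^ i = mk Θ n lam (mono Θ i 1) := by
  rw [← X_pow_eq_mono, map_pow]
  rfl

lemma Admissible.mk_mono (H : Admissible Θ n lam) (i : ℕ) (a : R) :
    mk Θ n lam (mono Θ i a) = qconst Θ n lam a * (H.x : SkewQuot Θ n lam) ^ i := by
  rw [H.x_pow, qconst_apply, ← map_mul, const_eq_mono, mono_mul_mono]
  simp

lemma Admissible.x_pow_mul (H : Admissible Θ n lam) (i : ℕ) (a : R) :
    (H.x : SkewQuot Θ n lam) ^ i * qconst Θ n lam a =
      qconst Θ n lam ((Θ ^ i) a) * (H.x : SkewQuot Θ n lam) ^ i := by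
  rw [← H.mk_mono, H.x_pow, qconst_apply, ← map_mul, const_eq_mono, mono_mul_mono]
  simp

lemma Admissible.inv_x_pow_mul (H : Admissible Θ n lam) (i : ℕ) (a : R) :
    ((H.x⁻¹ ^ i : (SkewQuot Θ n lam)ˣ) : SkewQuot Θ n lam) * qconst Θ n lam ((Θ ^ i) a) =
      qconst Θ n lam a * ((H.x⁻¹ ^ i : (SkewQuot Θ n lam)ˣ) : SkewQuot Θ n lam) := by
  have h := H.x_pow_mul i a
  rw [← Units.val_pow_eq_pow_val] at h
  rw [inv_pow, Units.inv_mul_eq_iff_eq_mul, ← mul_assoc, h, mul_assoc, Units.mul_inv, mul_one]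

lemma Admissible.x_pow_self (H : Admissible Θ n lam) :
    (H.x : SkewQuot Θ n lam) ^ n = qconst Θ n lam lam := by
  rw [H.x_pow, H.mk_mono_self, qconst_apply]

lemma Admissible.inv_x_pow (H : Admissible Θ n lam) {i : ℕ} (hi : i ≤ n) :
    ((H.x⁻¹ ^ i : (SkewQuot Θ n lam)ˣ) : SkewQuot Θ n lam) = mk Θ n lam (mono Θ (n - i) lam) := by
  rw [inv_pow, Units.inv_eq_of_mul_eq_one_right]
  rw [Units.val_pow_eq_pow_val, H.mk_mono, ← mul_assoc, H.x_pow_mul, H.pow_map_lam, mul_assoc,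
    ← pow_add, Nat.add_sub_cancel' hi, H.x_pow_self, ← map_mul, H.lam_mul_self, map_one]

/-- The anti-homomorphism to the quotient ring with `x ↦ x⁻¹` and `a ↦ Θ a`. -/
def Admissible.conjPoly (H : Admissible Θ n lam) : SkewPoly Θ →+* (SkewQuot Θ n lam)ᵐᵒᵖ :=
  SkewMonoidAlgebra.liftNCRingHom
    { toFun := fun a => MulOpposite.op (qconst Θ n lam (Θ ((toCoeff Θ).symm a)))
      map_one' := by simp
      map_mul' := fun a b => by simp [← MulOpposite.op_mul, ← map_mul, mul_comm]
      map_zero' := by simp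
      map_add' := fun a b => by simp }
    { toFun := fun k => MulOpposite.op
        ((H.x⁻¹ ^ (Multiplicative.toAdd k) : (SkewQuot Θ n lam)ˣ) : SkewQuot Θ n lam)
      map_one' := by simp
      map_mul' := fun a b => by
        rw [toAdd_mul, add_comm, pow_add, Units.val_mul, MulOpposite.op_mul] }
    -- In the opposite ring the compatibility demanded by the lift reads x⁻ᵏ Θᵏ⁺¹(a) = Θ(a) x⁻ᵏ.
    (by
      intro a k
      change MulOpposite.op _ * MulOpposite.op _ = MulOpposite.op _ * MulOpposite.op _
      rw [← MulOpposite.op_mul, ← MulOpposite.op_mul]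
      refine congrArg MulOpposite.op ?_
      rw [← H.inv_x_pow_mul]
      refine congrArg (fun b => _ * qconst Θ n lam b) ?_
      change (Θ * Θ ^ k.toAdd) _ = (Θ ^ k.toAdd * Θ) _
      rw [← pow_succ, ← pow_succ'])

lemma Admissible.conjPoly_mono (H : Admissible Θ n lam) (i : ℕ) (a : R) :
    H.conjPoly (mono Θ i a) = MulOpposite.op
      (((H.x⁻¹ ^ i : (SkewQuot Θ n lam)ˣ) : SkewQuot Θ n lam) * qconst Θ n lam (Θ a)) := by
  refine (SkewMonoidAlgebra.liftNC_single _ _ _ _).trans ?_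
  rw [MulOpposite.op_mul]
  rfl

/-- Here λ² = 1 enters: x⁻ⁿ = λ⁻¹ = λ, so inverting x preserves the relation and the map descends to
the quotient. -/
lemma Admissible.conjPoly_modulus (H : Admissible Θ n lam) :
    H.conjPoly (modulus Θ n lam) = 0 := by
  refine (congrArg H.conjPoly (modulus_eq Θ n lam)).trans ?_
  rw [map_sub, H.conjPoly_mono, H.conjPoly_mono, H.inv_x_pow le_rfl]
  simp [H.map_lam, qconst_apply, const_eq_mono]

/-- The involutive anti-automorphism of the quotient ring with `x ↦ x⁻¹` and `a ↦ Θ a`. -/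
def Admissible.conj (H : Admissible Θ n lam) : SkewQuot Θ n lam →+* (SkewQuot Θ n lam)ᵐᵒᵖ :=
  RingCon.lift _ H.conjPoly <| by
    intro f g hfg
    have h : mk Θ n lam (f - g) = 0 := by
      rw [map_sub, sub_eq_zero]
      exact (RingCon.eq _).2 hfg
    obtain ⟨s, hs⟩ := H.mk_eq_zero.1 h
    rw [RingCon.ker_apply, ← sub_eq_zero, ← map_sub, hs, map_mul, H.conjPoly_modulus, zero_mul]

/-- The involution as a function to the quotient ring itself. -/
def Admissible.bar (H : Admissible Θ n lam) (w : SkewQuot Θ n lam) : SkewQuot Θ n lam :=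
  (H.conj w).unop

lemma Admissible.bar_mul (H : Admissible Θ n lam) (v w : SkewQuot Θ n lam) :
    H.bar (v * w) = H.bar w * H.bar v := by
  simp [bar]

lemma Admissible.bar_add (H : Admissible Θ n lam) (v w : SkewQuot Θ n lam) :
    H.bar (v + w) = H.bar v + H.bar w := by
  simp [bar]

@[simp] lemma Admissible.bar_zero (H : Admissible Θ n lam) : H.bar 0 = 0 := by
  simp [bar]

@[simp] lemma Admissible.bar_one (H : Admissible Θ n lam) : H.bar 1 = 1 := by
  simp [bar]

lemma Admissible.bar_mono (H : Admissible Θ n lam) (i : ℕ) (a : R) :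
    H.bar (mk Θ n lam (mono Θ i a)) =
      ((H.x⁻¹ ^ i : (SkewQuot Θ n lam)ˣ) : SkewQuot Θ n lam) * qconst Θ n lam (Θ a) :=
  congrArg MulOpposite.unop (H.conjPoly_mono i a)

lemma Admissible.bar_qconst (H : Admissible Θ n lam) (a : R) :
    H.bar (qconst Θ n lam a) = qconst Θ n lam (Θ a) := by
  rw [qconst_apply, const_eq_mono, H.bar_mono]
  simp

lemma Admissible.bar_inv_x_pow (H : Admissible Θ n lam) (i : ℕ) :
    H.bar ((H.x⁻¹ ^ i : (SkewQuot Θ n lam)ˣ) : SkewQuot Θ n lam) =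
      (H.x : SkewQuot Θ n lam) ^ i := by
  have h1 : H.bar ((H.x : SkewQuot Θ n lam) ^ i) =
      ((H.x⁻¹ ^ i : (SkewQuot Θ n lam)ˣ) : SkewQuot Θ n lam) := by
    rw [H.x_pow, H.bar_mono]
    simp
  have h2 := H.bar_mul ((H.x : SkewQuot Θ n lam) ^ i)
    ((H.x⁻¹ ^ i : (SkewQuot Θ n lam)ˣ) : SkewQuot Θ n lam)
  rw [h1, inv_pow, ← Units.val_pow_eq_pow_val, Units.mul_inv, H.bar_one, eq_comm,
    Units.mul_inv_eq_iff_eq_mul, one_mul] at h2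
  rw [inv_pow, h2, Units.val_pow_eq_pow_val]

@[simp] lemma Admissible.bar_bar (H : Admissible Θ n lam) (w : SkewQuot Θ n lam) :
    H.bar (H.bar w) = w := by
  obtain ⟨f, rfl⟩ := mk_surjective _ _ _ w
  induction f using poly_induction with
  | add f g hf hg => rw [map_add, H.bar_add, H.bar_add, hf, hg]
  | mono i a =>
    rw [H.bar_mono, H.bar_mul, H.bar_qconst, H.bar_inv_x_pow, H.mk_mono]
    refine congrArg (fun b => qconst Θ n lam b * _) ?_
    change (Θ * Θ) a = a
    rw [← pow_two, H.sq_eq, RingAut.one_apply]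

/-- On a monomial, xᵏ · bar(a xⁱ) = xᵏ⁻ⁱ Θ(a) = Θᵏ⁻ⁱ(Θ(a)) xᵏ⁻ⁱ. This links the polynomial
generators of the theorem to the involution, up to a unit. -/
lemma Admissible.mk_twist_reciprocal (H : Admissible Θ n lam) {k : ℕ} {h : SkewPoly Θ}
    (hk : DegLT h (k + 1)) :
    mk Θ n lam (twist (reciprocal k h)) =
      ((H.x ^ k : (SkewQuot Θ n lam)ˣ) : SkewQuot Θ n lam) * H.bar (mk Θ n lam h) := by
  let B : SkewPoly Θ →+ SkewQuot Θ n lam :=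
    AddMonoidHom.mk' (fun f => H.bar (mk Θ n lam f)) fun f g => by rw [map_add, H.bar_add]
  conv_rhs => rw [← hk.ofCf_cf]
  change ((mk Θ n lam).toAddMonoidHom.comp (twistHom Θ)) _ = _ * B _
  rw [reciprocal, ofCf, map_sum, map_sum, Finset.mul_sum]
  refine Finset.sum_congr rfl fun i hi => ?_
  have hik : i ≤ k := Nat.lt_succ_iff.1 (Finset.mem_range.1 hi)
  change mk Θ n lam (twist _) = _ * H.bar _
  rw [twist_mono, H.mk_mono, H.bar_mono, ← mul_assoc, ← Units.val_mul, inv_pow,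
    show H.x ^ k * (H.x ^ i)⁻¹ = H.x ^ (k - i) by rw [pow_sub _ hik], Units.val_pow_eq_pow_val,
    H.x_pow_mul]
  refine congrArg (fun b => qconst Θ n lam b * _) ?_
  change (Θ * Θ ^ (k - i)) _ = (Θ ^ (k - i) * Θ) _
  rw [← pow_succ, ← pow_succ']

/-! ### The coefficient vector of an element of the quotient ring -/

/-- Reduction of a skew polynomial modulo `x ^ n - lam`, as a coefficient vector. -/
def Admissible.fold (H : Admissible Θ n lam) : SkewPoly Θ →+ (Fin n → R) :=
  SkewMonoidAlgebra.liftNC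
    ((Pi.constRingHom (Fin n) R).comp ((toCoeff Θ).symm : Coeff Θ →+* R) : Coeff Θ →+ (Fin n → R))
    fun i => Pi.single (⟨Multiplicative.toAdd i % n, Nat.mod_lt _ H.pos⟩ : Fin n)
      (lam ^ (Multiplicative.toAdd i / n))

lemma Admissible.fold_mono (H : Admissible Θ n lam) (i : ℕ) (a : R) :
    H.fold (mono Θ i a) =
      Pi.single (⟨i % n, Nat.mod_lt _ H.pos⟩ : Fin n) (a * lam ^ (i / n)) := by
  refine (SkewMonoidAlgebra.liftNC_single _ _ _ _).trans ?_
  ext j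
  by_cases h : j = ⟨i % n, Nat.mod_lt _ H.pos⟩
  · subst h
    simp [Pi.single_eq_same]
  · simp [Pi.single_eq_of_ne h]

lemma Admissible.fold_mul_modulus (H : Admissible Θ n lam) (s : SkewPoly Θ) :
    H.fold (modulus Θ n lam * s) = 0 := by
  rw [H.modulus_comm]
  induction s using poly_induction with
  | add f g hf hg => rw [add_mul, map_add, hf, hg, add_zero]
  | mono i a =>
    rw [modulus_eq, mul_sub, mono_mul_mono, mono_mul_mono, map_sub, H.fold_mono, H.fold_mono,
      map_one, mul_one, add_zero, H.pow_map_lam]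
    simp only [Nat.add_mod_right, Nat.add_div_right i H.pos]
    rw [pow_succ', mul_assoc, sub_self]

lemma Admissible.fold_eq_of_mk_eq (H : Admissible Θ n lam) {f g : SkewPoly Θ}
    (h : mk Θ n lam f = mk Θ n lam g) : H.fold f = H.fold g := by
  rw [← sub_eq_zero, ← map_sub] at h
  obtain ⟨s, hs⟩ := H.mk_eq_zero.1 h
  rw [← sub_eq_zero, ← map_sub, hs, H.fold_mul_modulus]

/-- The coefficient vector of an element of the quotient ring. -/
def Admissible.vec (H : Admissible Θ n lam) (w : SkewQuot Θ n lam) : Fin n → R :=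
  H.fold (Function.surjInv (mk_surjective Θ n lam) w)

lemma Admissible.vec_mk (H : Admissible Θ n lam) (f : SkewPoly Θ) :
    H.vec (mk Θ n lam f) = H.fold f :=
  H.fold_eq_of_mk_eq (Function.surjInv_eq _ _)

lemma ofVec_eq_sum_mono (v : Fin n → R) : ofVec Θ v = ∑ i : Fin n, mono Θ i (v i) := rfl

/-- Replacing each xⁿ by λ does not change the class, so every class has a representative given by a
coefficient vector. -/
lemma Admissible.mk_ofVec_fold (H : Admissible Θ n lam) (f : SkewPoly Θ) :
    mk Θ n lam (ofVec Θ (H.fold f)) = mk Θ n lam f := by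
  induction f using poly_induction with
  | add f g hf hg =>
    rw [map_add, map_add, ← hf, ← hg, ← map_add]
    simp [ofVec_eq_sum_mono, mono_add, Finset.sum_add_distrib]
  | mono i a =>
    rw [H.fold_mono, ofVec_eq_sum_mono, Finset.sum_eq_single ⟨i % n, Nat.mod_lt _ H.pos⟩]
    · rw [Pi.single_eq_same, H.mk_mono, H.mk_mono, map_mul, map_pow, mul_assoc, ← H.x_pow_self,
        ← pow_mul, ← pow_add, Nat.div_add_mod]
    · intro j _ hj
      rw [Pi.single_eq_of_ne hj, mono_zero]
    · simp

lemma Admissible.mk_ofVec_surjective (H : Admissible Θ n lam) :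
    Function.Surjective fun v : Fin n → R => mk Θ n lam (ofVec Θ v) := by
  intro w
  obtain ⟨f, rfl⟩ := mk_surjective _ _ _ w
  exact ⟨_, H.mk_ofVec_fold f⟩

/-! ### The Hermitian dual -/

/-- The constant coefficient of an element of the quotient ring. -/
def Admissible.trace (H : Admissible Θ n lam) : SkewQuot Θ n lam →+ R :=
  AddMonoidHom.mk' (fun w => H.vec w ⟨0, H.pos⟩) fun v w => by
    obtain ⟨f, rfl⟩ := mk_surjective _ _ _ v
    obtain ⟨g, rfl⟩ := mk_surjective _ _ _ w
    rw [← map_add, H.vec_mk, H.vec_mk, H.vec_mk, map_add]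
    rfl

lemma Admissible.trace_mono_mul_bar_mono (H : Admissible Θ n lam) {i j : ℕ} (hi : i < n)
    (hj : j < n) (a b : R) :
    H.trace (mk Θ n lam (mono Θ i a) * H.bar (mk Θ n lam (mono Θ j b))) =
      if i = j then a * Θ b else 0 := by
  rw [H.bar_mono, H.inv_x_pow hj.le, qconst_apply, ← map_mul, ← map_mul, const_eq_mono,
    mono_mul_mono, mono_mul_mono, add_zero]
  change H.vec _ _ = _
  rw [H.vec_mk, H.fold_mono]
  by_cases h : i = j
  · subst h
    have h1 : i + (n - i) = n := by omega
    have h2 : (⟨0, H.pos⟩ : Fin n) = ⟨(i + (n - i)) % n, Nat.mod_lt _ H.pos⟩ := by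
      simp [h1]
    rw [if_pos rfl, h2, Pi.single_eq_same, h1, Nat.div_self H.pos, pow_one,
      map_mul, H.pow_map_lam, ← RingAut.mul_apply (Θ ^ i), ← pow_add, h1, H.pow_eq,
      RingAut.one_apply]
    linear_combination a * Θ b * H.lam_mul_self
  · rw [if_neg h, Pi.single_eq_of_ne]
    simp only [ne_eq, Fin.mk.injEq]
    -- For `i ≠ j` the exponent `i + (n - j)` lies strictly between 0 and 2n and differs from n, so
    -- it cannot reduce to the constant term.
    intro h0
    obtain ⟨c, hc⟩ := Nat.dvd_of_mod_eq_zero h0.symm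
    have : c = 1 := by
      rcases c with _ | _ | c
      · omega
      · rfl
      · have : n * 2 ≤ n * (c + 1 + 1) := Nat.mul_le_mul_left n (by omega)
        omega
    subst this
    omega

lemma Admissible.trace_mul_bar (H : Admissible Θ n lam) (v w : Fin n → R) :
    H.trace (mk Θ n lam (ofVec Θ v) * H.bar (mk Θ n lam (ofVec Θ w))) =
      hermitianInner Θ v w := by
  let B : SkewPoly Θ →+ SkewQuot Θ n lam :=
    AddMonoidHom.mk' (fun f => H.bar (mk Θ n lam f)) fun f g => by rw [map_add, H.bar_add]
  change H.trace (_ * B _) = _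
  rw [ofVec_eq_sum_mono, ofVec_eq_sum_mono, map_sum, map_sum, Finset.sum_mul_sum, map_sum]
  refine Finset.sum_congr rfl fun i _ => ?_
  rw [map_sum, Finset.sum_eq_single i]
  · exact (H.trace_mono_mul_bar_mono i.2 i.2 _ _).trans (if_pos rfl)
  · intro j _ hj
    exact (H.trace_mono_mul_bar_mono i.2 j.2 _ _).trans (if_neg fun h => hj (Fin.ext h.symm))
  · simp

/-- Nondegeneracy: pairing with the unit vectors reads off the coefficients. -/
lemma Admissible.eq_zero_of_trace (H : Admissible Θ n lam) {w : SkewQuot Θ n lam}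
    (h : ∀ s, H.trace (w * H.bar s) = 0) : w = 0 := by
  obtain ⟨v, rfl⟩ := H.mk_ofVec_surjective w
  have hv : v = 0 := by
    ext j
    have := h (mk Θ n lam (ofVec Θ (Pi.single j 1)))
    rw [H.trace_mul_bar, hermitianInner, Finset.sum_eq_single j] at this
    · simpa using this
    · intro i _ hi
      rw [Pi.single_eq_of_ne hi, map_zero, mul_zero]
    · simp
  simp [hv, ofVec_eq_sum_mono]

/-- The left ideal of the elements whose image under the involution is annihilated by `C`
from the left. -/
def Admissible.dualIdeal (H : Admissible Θ n lam) (C : Ideal (SkewQuot Θ n lam)) :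
    Ideal (SkewQuot Θ n lam) where
  carrier := {w | ∀ c ∈ C, c * H.bar w = 0}
  zero_mem' c _ := by simp
  add_mem' {v w} hv hw c hc := by rw [H.bar_add, mul_add, hv c hc, hw c hc, add_zero]
  smul_mem' s w hw c hc := by rw [smul_eq_mul, H.bar_mul, ← mul_assoc, hw c hc, zero_mul]

lemma Admissible.mem_dualIdeal (H : Admissible Θ n lam) {C : Ideal (SkewQuot Θ n lam)}
    {w : SkewQuot Θ n lam} : w ∈ H.dualIdeal C ↔ ∀ c ∈ C, c * H.bar w = 0 := Iff.rfl

theorem Admissible.hermitianDual_code (H : Admissible Θ n lam) (C : Ideal (SkewQuot Θ n lam)) :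
    hermitianDual Θ (code C) = code (H.dualIdeal C) := by
  ext v
  change (∀ c, mk Θ n lam (ofVec Θ c) ∈ C → hermitianInner Θ v c = 0) ↔
    ∀ c ∈ C, c * H.bar (mk Θ n lam (ofVec Θ v)) = 0
  constructor
  · intro h c hc
    -- Since `C` is a left ideal, orthogonality to all `s * c` makes the trace of v · bar(c) ·
    -- bar(s) vanish for every `s`; nondegeneracy turns this into an equation in the ring.
    have h0 : mk Θ n lam (ofVec Θ v) * H.bar c = 0 := by
      refine H.eq_zero_of_trace fun s => ?_
      rw [mul_assoc, ← H.bar_mul]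
      obtain ⟨w, hw⟩ := H.mk_ofVec_surjective (s * c)
      change mk Θ n lam (ofVec Θ w) = s * c at hw
      rw [← hw, H.trace_mul_bar]
      exact h w (hw ▸ C.mul_mem_left s hc)
    rw [← H.bar_bar c, ← H.bar_mul, h0, H.bar_zero]
  · intro h c hc
    rw [← H.trace_mul_bar, ← H.bar_bar (mk Θ n lam (ofVec Θ v)), ← H.bar_mul, h _ hc,
      H.bar_zero, map_zero]

/-- The involution carries the right ideal a·S + b·S to the left ideal generated by bar(a) and
bar(b), and left unit factors on these generators are harmless. -/
lemma Admissible.dualIdeal_eq_span_pair (H : Admissible Θ n lam) {C : Ideal (SkewQuot Θ n lam)}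
    {a b p q : SkewQuot Θ n lam}
    (hC : ∀ w, (∀ c ∈ C, c * w = 0) ↔ ∃ s t, w = a * s + b * t)
    {d e : (SkewQuot Θ n lam)ˣ} (hp : p = d * H.bar a) (hq : q = e * H.bar b) :
    H.dualIdeal C = Ideal.span {p, q} := by
  ext w
  rw [H.mem_dualIdeal, hC, Ideal.mem_span_pair, hp, hq]
  constructor
  · rintro ⟨s, t, h⟩
    refine ⟨H.bar s * ↑d⁻¹, H.bar t * ↑e⁻¹, ?_⟩
    rw [mul_assoc, Units.inv_mul_cancel_left, mul_assoc, Units.inv_mul_cancel_left, ← H.bar_mul,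
      ← H.bar_mul, ← H.bar_add, ← h, H.bar_bar]
  · rintro ⟨s, t, rfl⟩
    refine ⟨H.bar (s * d), H.bar (t * e), ?_⟩
    rw [H.bar_add, ← mul_assoc, ← mul_assoc, H.bar_mul (s * d), H.bar_mul (t * e), H.bar_bar,
      H.bar_bar]

lemma Admissible.dualIdeal_eq_span_singleton (H : Admissible Θ n lam)
    {C : Ideal (SkewQuot Θ n lam)} {a p : SkewQuot Θ n lam}
    (hC : ∀ w, (∀ c ∈ C, c * w = 0) ↔ ∃ s, w = a * s)
    {d : (SkewQuot Θ n lam)ˣ} (hp : p = d * H.bar a) :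
    H.dualIdeal C = Ideal.span {p} := by
  rw [H.dualIdeal_eq_span_pair (a := a) (b := a) (q := p) ?_ hp hp, Set.pair_eq_singleton]
  intro w
  rw [hC]
  constructor
  · rintro ⟨s, rfl⟩
    exact ⟨s, 0, by simp⟩
  · rintro ⟨s, t, rfl⟩
    exact ⟨s + t, (mul_add _ _ _).symm⟩

end Quotient

/-! ### Skew polynomials over F + uF and the nilpotent element u. -/

section DualNumbers

variable {F : Type*} [Field F] {Θ : RingAut F[ε]}

/-- The field `F` as a subring of `F + uF`. -/
def fieldSubring (F : Type*) [Field F] : Subring F[ε] := (TrivSqZeroExt.inlHom F F).range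

lemma mem_fieldSubring {a : F[ε]} : a ∈ fieldSubring F ↔ a.snd = 0 := by
  constructor
  · rintro ⟨b, rfl⟩
    exact TrivSqZeroExt.snd_inl _ _
  · intro h
    exact ⟨a.fst, TrivSqZeroExt.ext (TrivSqZeroExt.fst_inl _ _)
      ((TrivSqZeroExt.snd_inl _ _).trans h.symm)⟩

lemma inl_mem_fieldSubring (a : F) : (TrivSqZeroExt.inl a : F[ε]) ∈ fieldSubring F := ⟨a, rfl⟩

/-- With q = |F|, the image y of an element of F satisfies y^q = y, while the u-part of any q-th
power is a multiple of q = 0 in F. -/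
lemma map_mem_fieldSubring [Finite F] (Θ : RingAut F[ε]) {a : F[ε]} (ha : a ∈ fieldSubring F) :
    Θ a ∈ fieldSubring F := by
  have := Fintype.ofFinite F
  obtain ⟨b, rfl⟩ := ha
  have h : Θ (TrivSqZeroExt.inlHom F F b) ^ Fintype.card F = Θ (TrivSqZeroExt.inlHom F F b) := by
    rw [← map_pow, ← map_pow, FiniteField.pow_card]
  rw [mem_fieldSubring, ← h, TrivSqZeroExt.snd_pow, ← Nat.cast_smul_eq_nsmul F,
    FiniteField.cast_card_eq_zero, zero_smul]

/-- An automorphism preserves ε² = 0, and F has no nonzero element of square zero. -/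
lemma fst_pow_eps (Θ : RingAut F[ε]) (i : ℕ) : ((Θ ^ i) ε).fst = 0 := by
  have h : (Θ ^ i) ε * (Θ ^ i) ε = 0 := by
    rw [← map_mul, DualNumber.eps_mul_eps, map_zero]
  have h' := congrArg TrivSqZeroExt.fst h
  rw [TrivSqZeroExt.fst_mul, TrivSqZeroExt.fst_zero] at h'
  exact mul_self_eq_zero.1 h'

lemma snd_pow_eps_ne_zero (Θ : RingAut F[ε]) (i : ℕ) : ((Θ ^ i) ε).snd ≠ 0 := by
  intro h
  have h0 : (Θ ^ i) ε = 0 := TrivSqZeroExt.ext (fst_pow_eps Θ i) h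
  rw [EmbeddingLike.map_eq_zero_iff] at h0
  exact one_ne_zero (α := F) (congrArg TrivSqZeroExt.snd h0)

lemma eq_eps_mul_of_fst_eq_zero {a : F[ε]} (h : a.fst = 0) : a = ε * TrivSqZeroExt.inl a.snd := by
  ext <;> simp [h]

lemma inl_fst_add_eps_mul_inl_snd (a : F[ε]) :
    TrivSqZeroExt.inl a.fst + ε * TrivSqZeroExt.inl a.snd = a := by
  ext <;> simp

lemma isUnit_of_fst_ne_zero {a : F[ε]} (h : a.fst ≠ 0) : ∃ b, b * a = 1 := by
  have : IsUnit a := TrivSqZeroExt.isUnit_iff_isUnit_fst.2 h.isUnit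
  obtain ⟨b, hb⟩ := this.exists_left_inv
  exact ⟨b, hb⟩

lemma overField_iff {f : SkewPoly Θ} : OverField f ↔ ∀ i, (cf f i).snd = 0 := Iff.rfl

/-- The ring `F[x;θ]` as a subring of `(F + uF)[x;Θ]`. -/
def fieldPolys [Finite F] (Θ : RingAut F[ε]) : Subring (SkewPoly Θ) :=
  polyOver (fieldSubring F) fun _ => map_mem_fieldSubring Θ

lemma overField_iff_mem [Finite F] {f : SkewPoly Θ} : OverField f ↔ f ∈ fieldPolys Θ :=
  forall_congr' fun _ => mem_fieldSubring.symm

@[simp] lemma cf_u_mul (f : SkewPoly Θ) (i : ℕ) : cf (u Θ * f) i = ε * cf f i := cf_const_mul _ _ _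

lemma u_mul_u : u Θ * u Θ = 0 := by
  refine ext_cf fun i => ?_
  rw [cf_u_mul, u, const_eq_mono, cf_mono]
  split_ifs <;> simp

lemma u_mul_u_mul (f : SkewPoly Θ) : u Θ * (u Θ * f) = 0 := by
  rw [← mul_assoc, u_mul_u, zero_mul]

lemma fst_cf_add {f₀ f₁ : SkewPoly Θ} (i : ℕ) :
    (cf (f₀ + u Θ * f₁) i).fst = (cf f₀ i).fst := by
  rw [cf_add, cf_u_mul]; simp

lemma OverField.cf_eq {f : SkewPoly Θ} (h : OverField f) (i : ℕ) :
    cf f i = TrivSqZeroExt.inl (cf f i).fst :=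
  TrivSqZeroExt.ext (TrivSqZeroExt.fst_inl _ _).symm
    ((h i).trans (TrivSqZeroExt.snd_inl _ _).symm)

lemma OverField.cf_eq_zero {f : SkewPoly Θ} (h : OverField f) {i : ℕ} (hi : (cf f i).fst = 0) :
    cf f i = 0 := by
  rw [h.cf_eq, hi, TrivSqZeroExt.inl_zero]

lemma OverField.eq_zero_of_u_mul {f : SkewPoly Θ} (h : OverField f) (h0 : u Θ * f = 0) :
    f = 0 := by
  refine ext_cf fun i => h.cf_eq_zero ?_
  have := congrArg (fun g => (cf g i).snd) h0
  simpa using this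

lemma OverField.u_mul_cancel [Finite F] {f g : SkewPoly Θ}
    (hf : OverField f) (hg : OverField g) (h : u Θ * f = u Θ * g) : f = g := by
  rw [overField_iff_mem] at hf hg
  refine sub_eq_zero.1 (OverField.eq_zero_of_u_mul (overField_iff_mem.2 (sub_mem hf hg)) ?_)
  rw [mul_sub, h, sub_self]

lemma DegLT.left_of_add {f₀ f₁ : SkewPoly Θ} {d : ℕ} (h : DegLT (f₀ + u Θ * f₁) d)
    (h₀ : OverField f₀) : DegLT f₀ d := fun i hi => by
  refine h₀.cf_eq_zero ?_
  rw [← fst_cf_add (f₁ := f₁), h i hi, TrivSqZeroExt.fst_zero]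

lemma DegLT.u_mul {f : SkewPoly Θ} {d : ℕ} (h : DegLT f d) : DegLT (u Θ * f) d := h.const_mul _

lemma MonicOf.left_of_add {f₀ f₁ : SkewPoly Θ} {d : ℕ} (h : MonicOf (f₀ + u Θ * f₁) d)
    (h₀ : OverField f₀) : MonicOf f₀ d := by
  refine ⟨?_, h.degLT.left_of_add h₀⟩
  rw [h₀.cf_eq, ← fst_cf_add (f₁ := f₁), h.cf_eq]
  rfl

lemma monicOf_of_leadingCoeff_eq {g : SkewPoly Θ} (hg : OverField g) {d : ℕ}
    (h0 : cf (u Θ * g) d ≠ 0) (hd : DegLT (u Θ * g) (d + 1))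
    (h : leadingCoeff (u Θ * g) = ε) : MonicOf g d := by
  rw [leadingCoeff_eq h0 hd, cf_u_mul] at h
  refine ⟨?_, fun i hi => hg.cf_eq_zero ?_⟩
  · have := congrArg TrivSqZeroExt.snd h
    rw [hg.cf_eq]
    simp only [DualNumber.snd_mul, DualNumber.fst_eps, DualNumber.snd_eps, zero_mul, one_mul,
      zero_add] at this
    rw [this]
    rfl
  · have := congrArg TrivSqZeroExt.snd (hd i hi)
    simpa using this

lemma overField_ofCf_inl (d : ℕ) (a : ℕ → F) :
    OverField (ofCf Θ d fun i => TrivSqZeroExt.inl (a i)) := by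
  rw [overField_iff]
  intro i
  rw [cf_ofCf]
  split_ifs <;> simp

lemma exists_decomp (f : SkewPoly Θ) :
    ∃ f₀ f₁, OverField f₀ ∧ OverField f₁ ∧ f = f₀ + u Θ * f₁ := by
  obtain ⟨N, hN⟩ := exists_degLT f
  refine ⟨ofCf Θ N fun i => TrivSqZeroExt.inl (cf f i).fst,
    ofCf Θ N fun i => TrivSqZeroExt.inl (cf f i).snd, overField_ofCf_inl _ _,
    overField_ofCf_inl _ _, ext_cf fun i => ?_⟩
  rw [cf_add, cf_u_mul, cf_ofCf, cf_ofCf]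
  split_ifs with h
  · exact (inl_fst_add_eps_mul_inl_snd _).symm
  · rw [hN i (not_lt.1 h)]; simp

lemma exists_eq_u_mul_of_u_mul_eq_zero {f : SkewPoly Θ} (h : u Θ * f = 0) :
    ∃ t, OverField t ∧ f = u Θ * t := by
  obtain ⟨f₀, f₁, h₀, h₁, rfl⟩ := exists_decomp f
  rw [mul_add, u_mul_u_mul, add_zero] at h
  exact ⟨f₁, h₁, by rw [h₀.eq_zero_of_u_mul h, zero_add]⟩

/-- Each Θⁱ(ε) is ε times an element of F, so an ε can be extracted on the left. The result `k` is
the arrow-u transform of `f`. -/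
lemma exists_mul_u_eq (f : SkewPoly Θ) :
    ∃ k, OverField k ∧ f * u Θ = u Θ * k ∧ ∀ d, DegLT f d → DegLT k d := by
  obtain ⟨N, hN⟩ := exists_degLT f
  refine ⟨ofCf Θ N fun i => TrivSqZeroExt.inl (cf f i * (Θ ^ i) ε).snd, overField_ofCf_inl _ _,
    ext_cf fun i => ?_, fun d hd i hi => ?_⟩
  · rw [u, cf_mul_const, cf_const_mul, cf_ofCf]
    split_ifs with h
    · exact eq_eps_mul_of_fst_eq_zero (by rw [TrivSqZeroExt.fst_mul, fst_pow_eps, mul_zero])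
    · rw [hN i (not_lt.1 h)]; simp
  · rw [cf_ofCf, hd i hi]; simp

/-- The scalars by which Θⁱ rescales ε are nonzero, so dividing by them moves `u` to the right. This
lets left multiples of `g₁` be lifted to left multiples of `u * g₁`. -/
lemma exists_u_mul_eq (k : SkewPoly Θ) : ∃ q, u Θ * k = q * u Θ := by
  obtain ⟨N, hN⟩ := exists_degLT k
  refine ⟨ofCf Θ N fun i => cf k i * TrivSqZeroExt.inl ((Θ ^ i) ε).snd⁻¹, ext_cf fun i => ?_⟩
  rw [u, cf_mul_const, cf_const_mul, cf_ofCf]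
  split_ifs with h
  · have h1 := eq_eps_mul_of_fst_eq_zero (fst_pow_eps Θ i)
    have h2 : (TrivSqZeroExt.inl ((Θ ^ i) ε).snd⁻¹ : F[ε]) *
        TrivSqZeroExt.inl ((Θ ^ i) ε).snd = 1 := by
      rw [← TrivSqZeroExt.inl_mul, inv_mul_cancel₀ (snd_pow_eps_ne_zero Θ i),
        TrivSqZeroExt.inl_one]
    linear_combination (-(cf k i * ε)) * h2 -
      cf k i * TrivSqZeroExt.inl ((Θ ^ i) ε).snd⁻¹ * h1
  · rw [hN i (not_lt.1 h)]; simp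

/-- The right-hand `u` moves left past `f`, where it meets the other `u`. -/
lemma u_mul_mul_u (f : SkewPoly Θ) : u Θ * (f * u Θ) = 0 := by
  obtain ⟨k, -, hk, -⟩ := exists_mul_u_eq f
  rw [hk, u_mul_u_mul]

lemma u_mul_mul_u_mul (f g : SkewPoly Θ) : u Θ * (f * (u Θ * g)) = 0 := by
  rw [← mul_assoc f, ← mul_assoc, u_mul_mul_u, zero_mul]

/-- Only the F-part of `z` matters after multiplication by `u`, and there a monic `g` over F can be
cancelled. -/
lemma MonicOf.u_mul_eq_zero [Finite F] {g z : SkewPoly Θ}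
    {d : ℕ} (hg : MonicOf g d) (hgF : OverField g) (h : u Θ * (g * z) = 0) : u Θ * z = 0 := by
  obtain ⟨z₀, z₁, h₀, h₁, rfl⟩ := exists_decomp z
  rw [mul_add, mul_add, u_mul_mul_u_mul, add_zero] at h
  have h2 : OverField (g * z₀) := by
    rw [overField_iff_mem] at *
    exact mul_mem hgF h₀
  rw [hg.eq_zero_of_mul_left (h2.eq_zero_of_u_mul h), zero_add, u_mul_u_mul]

lemma const_mul_u_mul (a : F[ε]) (f : SkewPoly Θ) :
    const Θ a * (u Θ * f) = u Θ * (const Θ a * f) := by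
  refine ext_cf fun i => ?_
  rw [cf_const_mul, cf_u_mul, cf_u_mul, cf_const_mul, mul_left_comm]

end DualNumbers

/-! ### Left ideals, minimal degrees and monic generators. -/

section LeftIdeals

variable {R : Type*} [CommRing R] {Θ : RingAut R} {n : ℕ} {lam : R}
  {C : Ideal (SkewQuot Θ n lam)}

/-- The only skew polynomial of degree less than `d` whose class lies in `C` is zero. -/
def NoneBelow (C : Ideal (SkewQuot Θ n lam)) (d : ℕ) : Prop :=
  ∀ f, mk Θ n lam f ∈ C → DegLT f d → f = 0

lemma mk_mul_mem (a : SkewPoly Θ) {f : SkewPoly Θ} (h : mk Θ n lam f ∈ C) :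
    mk Θ n lam (a * f) ∈ C := by
  rw [map_mul]
  exact C.mul_mem_left _ h

lemma mk_sub_mem {f g : SkewPoly Θ} (hf : mk Θ n lam f ∈ C) (hg : mk Θ n lam g ∈ C) :
    mk Θ n lam (f - g) ∈ C := by
  rw [map_sub]
  exact C.sub_mem hf hg

lemma Admissible.mk_modulus_mem (H : Admissible Θ n lam) : mk Θ n lam (modulus Θ n lam) ∈ C := by
  rw [H.mk_modulus]
  exact C.zero_mem

lemma mem_reps {f : SkewPoly Θ} : f ∈ reps C ↔ DegLT f n ∧ mk Θ n lam f ∈ C :=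
  and_congr_left fun _ => degree_lt_iff

lemma Admissible.exists_rep (H : Admissible Θ n lam) (w : SkewQuot Θ n lam) :
    ∃ f, DegLT f n ∧ mk Θ n lam f = w := by
  obtain ⟨g, rfl⟩ := mk_surjective _ _ _ w
  obtain ⟨q, r, h, hr⟩ := H.monicOf_modulus.exists_div' g
  exact ⟨r, hr, by rw [h, map_add, map_mul, H.mk_modulus, mul_zero, zero_add]⟩

lemma Admissible.noneBelow_bot (H : Admissible Θ n lam) :
    NoneBelow (⊥ : Ideal (SkewQuot Θ n lam)) n := by
  intro f hf hd
  obtain ⟨s, rfl⟩ := H.mk_eq_zero.1 ((Submodule.mem_bot _).1 hf)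
  rw [H.modulus_comm] at hd
  have hs := (H.monicOf_modulus.degLT_of_mul (N := 0) (by rwa [zero_add])).eq_zero
  rw [hs, mul_zero]

lemma noneBelow_of_mem_minReps {f : SkewPoly Θ} (h : f ∈ minReps C) {d : ℕ} (hd : cf f d ≠ 0)
    (hd' : DegLT f (d + 1)) : d < n ∧ NoneBelow C d := by
  have hn : d < n := by
    by_contra hn
    exact hd ((mem_reps.1 h.1).1 d (not_lt.1 hn))
  refine ⟨hn, fun g hg hgd => ?_⟩
  by_contra hg0
  have := h.2.2 g (mem_reps.2 ⟨hgd.mono hn.le, hg⟩) hg0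
  rw [degree_eq hd hd'] at this
  exact absurd (degree_lt_iff.2 hgd) (not_lt.2 this)

lemma NoneBelow.mem_minReps {d : ℕ} (h : NoneBelow C d) (hn : d < n) {f : SkewPoly Θ}
    (hf : mk Θ n lam f ∈ C) (hd : cf f d ≠ 0) (hd' : DegLT f (d + 1)) : f ∈ minReps C := by
  refine ⟨mem_reps.2 ⟨hd'.mono hn, hf⟩, ?_, fun g hg hg0 => ?_⟩
  · rintro rfl
    exact hd (cf_zero d)
  · rw [degree_eq hd hd']
    by_contra hlt
    exact hg0 (h g (mem_reps.1 hg).2 (degree_lt_iff.1 (not_le.1 hlt)))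

/-- The remainder of right division by `g` lies in `C` below the minimal degree, hence vanishes.
Applied to the modulus, whose class is zero, it makes `g` a right divisor of it. -/
lemma NoneBelow.exists_eq_mul {g : SkewPoly Θ} {d : ℕ} (hd : NoneBelow C d) (hg : MonicOf g d)
    (hgC : mk Θ n lam g ∈ C) {f : SkewPoly Θ} (hf : mk Θ n lam f ∈ C) : ∃ q, f = q * g := by
  obtain ⟨q, r, h, hr⟩ := hg.exists_div' f
  refine ⟨q, ?_⟩
  have h1 : r = f - q * g := by rw [h]; abel
  rw [h, hd r (h1 ▸ mk_sub_mem hf (mk_mul_mem q hgC)) hr, add_zero]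

lemma NoneBelow.eq_span {g : SkewPoly Θ} {d : ℕ} (hd : NoneBelow C d) (hg : MonicOf g d)
    (hgC : mk Θ n lam g ∈ C) : C = Ideal.span {mk Θ n lam g} := by
  refine le_antisymm (fun w hw => ?_) ((Ideal.span_singleton_le_iff_mem _).2 hgC)
  obtain ⟨f, rfl⟩ := mk_surjective _ _ _ w
  obtain ⟨q, rfl⟩ := hd.exists_eq_mul hg hgC hw
  rw [map_mul]
  exact Ideal.mul_mem_left _ _ (Ideal.mem_span_singleton_self _)

/-- From (g h) g = g π = π g one cancels the monic `g` on the right. -/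
lemma Admissible.mul_eq_modulus_comm (H : Admissible Θ n lam) {g h : SkewPoly Θ} {d : ℕ}
    (hg : MonicOf g d) (hh : h * g = modulus Θ n lam) : g * h = modulus Θ n lam := by
  refine hg.cancel_right ?_
  rw [mul_assoc, hh, H.modulus_comm]

lemma Admissible.degLT_of_mul_eq_modulus (H : Admissible Θ n lam) {g h : SkewPoly Θ} {d : ℕ}
    (hg : MonicOf g d) (hd : d ≤ n) (hh : h * g = modulus Θ n lam) : DegLT h (n - d + 1) := by
  refine hg.degLT_of_mul ?_
  rw [hh, show n - d + 1 + d = n + 1 by omega]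
  exact H.monicOf_modulus.degLT

lemma Admissible.modulus_cancel_left (H : Admissible Θ n lam) {s : SkewPoly Θ}
    (h : modulus Θ n lam * s = 0) : s = 0 :=
  H.monicOf_modulus.eq_zero_of_mul_left h

lemma forall_mem_span_singleton_mul_eq_zero {S : Type*} [Ring S] {g w : S} :
    (∀ c ∈ Ideal.span {g}, c * w = 0) ↔ g * w = 0 := by
  constructor
  · exact fun h => h g (Ideal.mem_span_singleton_self g)
  · intro h c hc
    obtain ⟨a, rfl⟩ := Ideal.mem_span_singleton'.1 hc
    rw [mul_assoc, h, mul_zero]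

lemma forall_mem_span_pair_mul_eq_zero {S : Type*} [Ring S] {f g w : S} :
    (∀ c ∈ Ideal.span {f, g}, c * w = 0) ↔ f * w = 0 ∧ g * w = 0 := by
  constructor
  · exact fun h => ⟨h f (Ideal.subset_span (by simp)), h g (Ideal.subset_span (by simp))⟩
  · rintro ⟨h1, h2⟩ c hc
    obtain ⟨a, b, rfl⟩ := Ideal.mem_span_pair.1 hc
    rw [add_mul, mul_assoc, mul_assoc, h1, h2, mul_zero, mul_zero, add_zero]

/-- The dual of a left ideal generated by a monic right divisor of `x ^ n - lam`. -/
lemma Admissible.dualIdeal_of_monic (H : Admissible Θ n lam) {g h : SkewPoly Θ} {d : ℕ}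
    (hg : MonicOf g d) (hd : d ≤ n) (hh : h * g = modulus Θ n lam)
    (hC : C = Ideal.span {mk Θ n lam g}) :
    H.dualIdeal C = Ideal.span {mk Θ n lam (twist (reciprocal (n - d) h))} := by
  have hgh := H.mul_eq_modulus_comm hg hh
  refine H.dualIdeal_eq_span_singleton (a := mk Θ n lam h) (fun w => ?_)
    (H.mk_twist_reciprocal (H.degLT_of_mul_eq_modulus hg hd hh))
  rw [hC, forall_mem_span_singleton_mul_eq_zero]
  constructor
  · intro hw
    obtain ⟨z, rfl⟩ := mk_surjective _ _ _ w
    rw [← map_mul] at hw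
    obtain ⟨s, hs⟩ := H.mk_eq_zero.1 hw
    -- The relation becomes g z = g (h s), and `g` cancels on the left.
    rw [← hgh, mul_assoc] at hs
    exact ⟨mk Θ n lam s, by rw [hg.cancel_left hs, map_mul]⟩
  · rintro ⟨s, rfl⟩
    rw [← mul_assoc, ← map_mul, hgh, H.mk_modulus, zero_mul]

end LeftIdeals

/-! ### Generators and right annihilators of ideals involving u. -/

section DualNumbers

variable {F : Type*} [Field F] {Θ : RingAut F[ε]} {n : ℕ} {lam : F[ε]}
  {C : Ideal (SkewQuot Θ n lam)}

lemma Admissible.u_mul_modulus (H : Admissible Θ n lam) (s : SkewPoly Θ) :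
    u Θ * (modulus Θ n lam * s) = modulus Θ n lam * (u Θ * s) := by
  rw [← mul_assoc, ← H.modulus_comm, mul_assoc]

lemma Admissible.exists_of_u_mul_modulus (H : Admissible Θ n lam) {s : SkewPoly Θ}
    (h : u Θ * (modulus Θ n lam * s) = 0) : ∃ t, OverField t ∧ s = u Θ * t := by
  rw [H.u_mul_modulus] at h
  exact exists_eq_u_mul_of_u_mul_eq_zero (H.modulus_cancel_left h)

/-- Θ(ε) is ε times a nonzero scalar, so `u` itself may serve as a dual generator in place of
bar(u). -/
lemma Admissible.exists_unit_mul_bar_u (H : Admissible Θ n lam) :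
    ∃ e : (SkewQuot Θ n lam)ˣ, mk Θ n lam (u Θ) = e * H.bar (mk Θ n lam (u Θ)) := by
  have h0 : (Θ ε).snd ≠ 0 := snd_pow_eps_ne_zero Θ 1
  have h1 : Θ ε = ε * TrivSqZeroExt.inl (Θ ε).snd :=
    eq_eps_mul_of_fst_eq_zero (fst_pow_eps Θ 1)
  let v : (F[ε])ˣ := Units.map (TrivSqZeroExt.inlHom F F).toMonoidHom (Units.mk0 _ h0)
  refine ⟨Units.map (qconst Θ n lam).toMonoidHom v⁻¹, ?_⟩
  change qconst Θ n lam ε = qconst Θ n lam ↑v⁻¹ * H.bar (qconst Θ n lam ε)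
  rw [H.bar_qconst, ← map_mul, h1]
  change _ = qconst Θ n lam (Units.val v⁻¹ * (ε * Units.val v))
  rw [mul_comm ε, Units.inv_mul_cancel_left]

variable [Finite F]

/-- Divide `b` by `g₁` over F: `u` times the remainder lies in `C` below degree `d`, so the
remainder is zero. -/
lemma NoneBelow.exists_eq_mul_of_u_mul {g₁ : SkewPoly Θ} {d : ℕ} (hd : NoneBelow C d)
    (hg : MonicOf g₁ d) (hgF : OverField g₁) (hgC : mk Θ n lam (u Θ * g₁) ∈ C) {b : SkewPoly Θ}
    (hb : OverField b) (hbC : mk Θ n lam (u Θ * b) ∈ C) :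
    ∃ q ∈ fieldPolys Θ, b = q * g₁ := by
  obtain ⟨q, hq, r, hr, h, hrd⟩ := hg.exists_div (overField_iff_mem.1 hgF)
    (overField_iff_mem.1 hb)
  obtain ⟨q', hq'⟩ := exists_u_mul_eq q
  have h1 : u Θ * r = u Θ * b - q' * (u Θ * g₁) := by
    rw [← mul_assoc q', ← hq', h, mul_add, mul_assoc]; abel
  have h2 : u Θ * r = 0 := hd _ (h1 ▸ mk_sub_mem hbC (mk_mul_mem q' hgC)) hrd.u_mul
  exact ⟨q, hq, by rw [h, (overField_iff_mem.2 hr).eq_zero_of_u_mul h2, add_zero]⟩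

/-- Subtracting a left multiple of `u * g₁` reduces the u-part modulo `g₁` without touching `a`. -/
lemma exists_add_u_mul_mem {g₁ : SkewPoly Θ} {d : ℕ}
    (hg : MonicOf g₁ d) (hgF : OverField g₁) (hgC : mk Θ n lam (u Θ * g₁) ∈ C) {a b : SkewPoly Θ}
    (hb : OverField b) (hab : mk Θ n lam (a + u Θ * b) ∈ C) :
    ∃ r, OverField r ∧ DegLT r d ∧ mk Θ n lam (a + u Θ * r) ∈ C := by
  obtain ⟨q, hq, r, hr, h, hrd⟩ := hg.exists_div (overField_iff_mem.1 hgF)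
    (overField_iff_mem.1 hb)
  obtain ⟨q', hq'⟩ := exists_u_mul_eq q
  refine ⟨r, overField_iff_mem.2 hr, hrd, ?_⟩
  have h1 : a + u Θ * r = a + u Θ * b - q' * (u Θ * g₁) := by
    rw [← mul_assoc q', ← hq', h, mul_add, mul_assoc]; abel
  rw [h1]
  exact mk_sub_mem hab (mk_mul_mem q' hgC)

/-- If the monic elements of `C` have degree at least `N`, then every element of `C` of degree
less than `N` is a left multiple of `u g₁`. -/
lemma NoneBelow.exists_eq_mul_u_mul {g₁ : SkewPoly Θ} {d N : ℕ} (hd : NoneBelow C d)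
    (hg : MonicOf g₁ d) (hgF : OverField g₁) (hgC : mk Θ n lam (u Θ * g₁) ∈ C)
    (hN : ∀ f e, MonicOf f e → mk Θ n lam f ∈ C → N ≤ e) {c : SkewPoly Θ}
    (hc : mk Θ n lam c ∈ C) (hcN : DegLT c N) :
    ∃ q, c = q * (u Θ * g₁) := by
  obtain ⟨a, b, ha, hb, rfl⟩ := exists_decomp c
  -- Otherwise let e be the degree of `a`. As `u * a` is in `C`, d ≤ e, so trimming the u-part below
  -- d leaves an element with unit leading coefficient in degree e. Rescaled, it is monic of degree
  -- e < N, a contradiction.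
  have ha0 : a = 0 := by
    by_contra ha0
    obtain ⟨e, he, he'⟩ := exists_degree ha0
    have hua : mk Θ n lam (u Θ * a) ∈ C := by
      have := mk_mul_mem (u Θ) hc
      rwa [mul_add, u_mul_u_mul, add_zero] at this
    have hde : d ≤ e := by
      by_contra hde
      have h0 := hd _ hua (he'.u_mul.mono (by omega))
      exact ha0 (ha.eq_zero_of_u_mul h0)
    obtain ⟨r, hr, hrd, hrC⟩ := exists_add_u_mul_mem hg hgF hgC hb hc
    have hfst : (cf (a + u Θ * r) e).fst ≠ 0 := by
      rw [fst_cf_add]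
      exact fun h => he (ha.cf_eq_zero h)
    obtain ⟨t, ht⟩ := isUnit_of_fst_ne_zero hfst
    have hmon : MonicOf (const Θ t * (a + u Θ * r)) e :=
      ⟨by rw [cf_const_mul, ht], (he'.add (hrd.u_mul.mono (by omega))).const_mul t⟩
    have := hN _ e hmon (mk_mul_mem _ hrC)
    exact he (hcN.left_of_add ha e this)
  subst ha0
  rw [zero_add] at hc ⊢
  obtain ⟨q, -, rfl⟩ := hd.exists_eq_mul_of_u_mul hg hgF hgC hb hc
  obtain ⟨q', hq'⟩ := exists_u_mul_eq q
  exact ⟨q', by rw [← mul_assoc, hq', mul_assoc]⟩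

lemma NoneBelow.eq_span_u_mul (H : Admissible Θ n lam) {g₁ : SkewPoly Θ} {d : ℕ}
    (hd : NoneBelow C d) (hg : MonicOf g₁ d) (hgF : OverField g₁)
    (hgC : mk Θ n lam (u Θ * g₁) ∈ C) (hN : ∀ f e, MonicOf f e → mk Θ n lam f ∈ C → n ≤ e) :
    C = Ideal.span {mk Θ n lam (u Θ * g₁)} := by
  refine le_antisymm (fun w hw => ?_) ((Ideal.span_singleton_le_iff_mem C).2 hgC)
  obtain ⟨f, hf, rfl⟩ := H.exists_rep w
  obtain ⟨q, rfl⟩ := hd.exists_eq_mul_u_mul hg hgF hgC hN hw hf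
  rw [map_mul _ q]
  exact Ideal.mul_mem_left _ _ (Ideal.mem_span_singleton_self _)

lemma NoneBelow.eq_span_pair {g₁ f : SkewPoly Θ} {d e : ℕ}
    (hd : NoneBelow C d) (hg : MonicOf g₁ d) (hgF : OverField g₁)
    (hgC : mk Θ n lam (u Θ * g₁) ∈ C) (hf : MonicOf f e) (hfC : mk Θ n lam f ∈ C)
    (hN : ∀ f e', MonicOf f e' → mk Θ n lam f ∈ C → e ≤ e') :
    C = Ideal.span {mk Θ n lam (u Θ * g₁), mk Θ n lam f} := by
  refine le_antisymm (fun w hw => ?_) ?_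
  · obtain ⟨c, rfl⟩ := mk_surjective _ _ _ w
    obtain ⟨q, r, rfl, hr⟩ := hf.exists_div' c
    have hrC : mk Θ n lam r ∈ C := by
      have := mk_sub_mem hw (mk_mul_mem q hfC)
      rwa [add_sub_cancel_left] at this
    obtain ⟨p, rfl⟩ := hd.exists_eq_mul_u_mul hg hgF hgC hN hrC hr
    exact Ideal.mem_span_pair.2 ⟨mk Θ n lam p, mk Θ n lam q, by
      rw [← map_mul, ← map_mul, ← map_add, add_comm]⟩
  · rw [Ideal.span_le]
    rintro x (rfl | rfl)
    exacts [hgC, hfC]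

/-- The right annihilator of `u g₁` modulo `x ^ n - lam`. -/
lemma Admissible.exists_of_u_mul_mul (H : Admissible Θ n lam)
    {g₁ h w : SkewPoly Θ} {d : ℕ} (hg : MonicOf g₁ d) (hgF : OverField g₁)
    (hh : h * g₁ = modulus Θ n lam) (hw : mk Θ n lam (u Θ * g₁ * w) = 0) :
    ∃ s t, w = h * s + u Θ * t := by
  obtain ⟨s, hs⟩ := H.mk_eq_zero.1 hw
  have hgh := H.mul_eq_modulus_comm hg hh
  rw [mul_assoc] at hs
  -- Multiplying u g₁ w = π s by `u` and cancelling π forces `s` to be divisible by `u`.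
  obtain ⟨s₁, -, rfl⟩ := H.exists_of_u_mul_modulus (s := s) (by rw [← hs, u_mul_u_mul])
  have h1 : u Θ * (g₁ * (w - h * s₁)) = 0 := by
    rw [mul_sub, ← mul_assoc g₁, hgh, mul_sub, hs, H.u_mul_modulus, sub_self]
  obtain ⟨t, -, ht⟩ :=
    exists_eq_u_mul_of_u_mul_eq_zero (hg.u_mul_eq_zero hgF h1)
  exact ⟨s₁, t, by rw [← ht, add_sub_cancel]⟩

/-- The dual of the left ideal generated by `u g₁`, for a monic right divisor `g₁` of
`x ^ n - lam`. -/
lemma Admissible.dualIdeal_of_u_mul (H : Admissible Θ n lam)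
    {g₁ h : SkewPoly Θ} {d : ℕ} (hg : MonicOf g₁ d) (hgF : OverField g₁) (hd : d ≤ n)
    (hh : h * g₁ = modulus Θ n lam) (hC : C = Ideal.span {mk Θ n lam (u Θ * g₁)}) :
    H.dualIdeal C =
      Ideal.span {mk Θ n lam (u Θ), mk Θ n lam (twist (reciprocal (n - d) h))} := by
  obtain ⟨e, he⟩ := H.exists_unit_mul_bar_u
  refine H.dualIdeal_eq_span_pair (a := mk Θ n lam (u Θ)) (b := mk Θ n lam h) (fun w => ?_) he
    (H.mk_twist_reciprocal (H.degLT_of_mul_eq_modulus hg hd hh))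
  rw [hC, forall_mem_span_singleton_mul_eq_zero]
  constructor
  · intro hw
    obtain ⟨z, rfl⟩ := mk_surjective _ _ _ w
    rw [← map_mul] at hw
    obtain ⟨s, t, rfl⟩ := H.exists_of_u_mul_mul hg hgF hh hw
    exact ⟨mk Θ n lam t, mk Θ n lam s, by rw [map_add, map_mul, map_mul, add_comm]⟩
  · rintro ⟨s, t, rfl⟩
    rw [mul_add, ← mul_assoc, ← map_mul, ← mul_assoc, ← map_mul, mul_assoc, u_mul_mul_u,
      mul_assoc, H.mul_eq_modulus_comm hg hh, map_zero, zero_mul, zero_add, map_mul,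
      H.mk_modulus, mul_zero, zero_mul]

/-- The dual of the left ideal generated by `u g₁` and the monic `f₀ + u f₁`. -/
lemma Admissible.dualIdeal_of_pair (H : Admissible Θ n lam)
    {g₁ f₀ f₁ hf hg k m p : SkewPoly Θ} {d e : ℕ} (hg₁ : MonicOf g₁ d) (hg₁F : OverField g₁)
    (hf₀ : MonicOf f₀ e) (hhf : hf * f₀ = modulus Θ n lam) (hhg : hg * g₁ = modulus Θ n lam)
    (hk : hf * u Θ = u Θ * k) (hm : m * g₁ = k * f₁) (hp : f₀ = p * g₁)
    (hd : DegLT (hg - u Θ * m) (n - d + 1)) (he : DegLT (hf * u Θ) (n - e + 1))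
    (hC : C = Ideal.span {mk Θ n lam (u Θ * g₁), mk Θ n lam (f₀ + u Θ * f₁)}) :
    H.dualIdeal C =
      Ideal.span {mk Θ n lam (twist (reciprocal (n - e) (hf * u Θ))),
        mk Θ n lam (twist (reciprocal (n - d) (hg - u Θ * m)))} := by
  have hfh := H.mul_eq_modulus_comm hf₀ hhf
  have hgh := H.mul_eq_modulus_comm hg₁ hhg
  -- The defining property of `m`: after right multiplication by `g₁`, both sides become π u f₁. It
  -- makes the cross terms in `h4` cancel.
  have hum : f₀ * (u Θ * m) = u Θ * (f₁ * hg) := by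
    refine hg₁.cancel_right ?_
    rw [mul_assoc, mul_assoc, hm, ← mul_assoc (u Θ), ← hk, mul_assoc, ← mul_assoc, hfh,
      mul_assoc, mul_assoc, hhg, ← H.modulus_comm f₁, H.u_mul_modulus]
  have h1 : u Θ * g₁ * (hf * u Θ) = 0 := by
    rw [mul_assoc, ← mul_assoc g₁, u_mul_mul_u]
  have h2 : (f₀ + u Θ * f₁) * (hf * u Θ) = modulus Θ n lam * u Θ := by
    rw [add_mul, ← mul_assoc f₀, hfh, mul_assoc (u Θ), ← mul_assoc f₁, u_mul_mul_u, add_zero]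
  have h3 : u Θ * g₁ * (hg - u Θ * m) = modulus Θ n lam * u Θ := by
    rw [mul_assoc, mul_sub, hgh, mul_sub, u_mul_mul_u_mul, sub_zero, H.modulus_comm]
  have h4 : (f₀ + u Θ * f₁) * (hg - u Θ * m) = modulus Θ n lam * p := by
    have : f₀ * hg = modulus Θ n lam * p := by rw [hp, mul_assoc, hgh, H.modulus_comm]
    rw [add_mul, mul_sub, mul_sub, hum, this, mul_assoc (u Θ), mul_assoc (u Θ), u_mul_mul_u_mul]
    abel
  have hz : ∀ s, mk Θ n lam (modulus Θ n lam * s) = 0 := fun s => H.mk_eq_zero.2 ⟨s, rfl⟩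
  refine H.dualIdeal_eq_span_pair (a := mk Θ n lam (hf * u Θ)) (b := mk Θ n lam (hg - u Θ * m))
    (fun w => ?_) (H.mk_twist_reciprocal he) (H.mk_twist_reciprocal hd)
  rw [hC, forall_mem_span_pair_mul_eq_zero]
  constructor
  · rintro ⟨hw1, hw2⟩
    obtain ⟨z, rfl⟩ := mk_surjective _ _ _ w
    rw [← map_mul] at hw1 hw2
    obtain ⟨s, t, rfl⟩ := H.exists_of_u_mul_mul hg₁ hg₁F hhg hw1
    -- Shifting `t` by `m * s` replaces `hg * s` by the multiple `(hg - u Θ * m) * s` of the second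
    -- generator, which is already annihilated; only `u * t` remains to be treated.
    obtain ⟨t, ht⟩ : ∃ t', t' = t + m * s := ⟨_, rfl⟩
    have hdec : hg * s + u Θ * (t - m * s) = (hg - u Θ * m) * s + u Θ * t := by
      rw [mul_sub, sub_mul, mul_assoc]; abel
    obtain rfl : _ = t - m * s := eq_sub_of_add_eq ht.symm
    rw [hdec] at hw2 ⊢
    rw [mul_add, ← mul_assoc, h4, map_add, mul_assoc, hz, zero_add, add_mul, mul_assoc (u Θ),
      u_mul_mul_u_mul, add_zero] at hw2
    obtain ⟨s', hs'⟩ := H.mk_eq_zero.1 hw2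
    -- Again `s'` is divisible by `u`; since f₀ hf = π, cancelling `f₀` then yields u t = hf u s''.
    obtain ⟨s'', -, rfl⟩ := H.exists_of_u_mul_modulus (s := s') (by rw [← hs', u_mul_mul_u_mul])
    have : u Θ * t = hf * u Θ * s'' := by
      refine hf₀.cancel_left ?_
      rw [hs', ← mul_assoc, ← mul_assoc f₀, ← mul_assoc, hfh]
    exact ⟨mk Θ n lam s'', mk Θ n lam s, by
      rw [← map_mul, ← map_mul, ← map_add, this, add_comm]⟩
  · rintro ⟨s, t, rfl⟩
    constructor
    · rw [mul_add, ← mul_assoc, ← mul_assoc, ← map_mul, ← map_mul, h1, h3, hz, map_zero,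
        zero_mul, zero_mul, add_zero]
    · rw [mul_add, ← mul_assoc, ← mul_assoc, ← map_mul, ← map_mul, h2, h4, hz, hz,
        zero_mul, zero_mul, add_zero]

end DualNumbers

/-! ### The three types: existence, generators and duals. -/

section Types

variable {F : Type*} [Field F] {Θ : RingAut F[ε]} {n : ℕ} {lam : F[ε]}
  {C : Ideal (SkewQuot Θ n lam)}

lemma admissible (hΘ : orderOf Θ = 2) (hn : 0 < n) (hdvd : orderOf Θ ∣ n)
    (hlam : lam = 1 ∨ lam = -1) : Admissible Θ n lam := by
  refine ⟨hn, hΘ ▸ pow_orderOf_eq_one Θ, orderOf_dvd_iff_pow_eq_one.1 hdvd, ?_, ?_⟩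
  · rcases hlam with rfl | rfl <;> simp
  · rcases hlam with rfl | rfl <;> simp

lemma overField_modulus [Finite F] (hlam : lam = 1 ∨ lam = -1) : OverField (modulus Θ n lam) := by
  rw [modulus_eq, overField_iff_mem]
  refine sub_mem (mono_mem_polyOver (Subring.one_mem _) _) (mono_mem_polyOver ?_ _)
  rcases hlam with rfl | rfl
  exacts [Subring.one_mem _, Subring.neg_mem _ (Subring.one_mem _)]

lemma toLaurent_reciprocal_sub {d : ℕ} (hd : d ≤ n) {h : SkewPoly Θ}
    (hk : DegLT h (n - d + 1)) :
    toLaurent (reciprocal (n - d) h) = xpow Θ ((n : ℤ) - d) * antiHom h := by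
  rw [toLaurent_reciprocal hk, Nat.cast_sub hd]

/-- A left ideal contains a nonzero skew polynomial of minimal degree. -/
lemma Admissible.exists_noneBelow (H : Admissible Θ n lam) (hC : C ≠ ⊥) :
    ∃ d < n, NoneBelow C d ∧ ∃ f, mk Θ n lam f ∈ C ∧ cf f d ≠ 0 ∧ DegLT f (d + 1) := by
  classical
  obtain ⟨w, hw, hw0⟩ := Submodule.exists_mem_ne_zero_of_ne_bot hC
  obtain ⟨f, hf, rfl⟩ := H.exists_rep w
  have hf0 : f ≠ 0 := by
    rintro rfl
    exact hw0 (map_zero _)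
  obtain ⟨e, he, he'⟩ := exists_degree hf0
  have hex : ∃ d f, mk Θ n lam f ∈ C ∧ cf f d ≠ 0 ∧ DegLT f (d + 1) := ⟨e, f, hw, he, he'⟩
  have hen : e < n := by
    by_contra h
    exact he (hf e (not_lt.1 h))
  refine ⟨Nat.find hex, (Nat.find_min' hex ⟨f, hw, he, he'⟩).trans_lt hen, fun g hg hgd => ?_,
    Nat.find_spec hex⟩
  by_contra hg0
  obtain ⟨a, ha, ha'⟩ := exists_degree hg0
  refine Nat.find_min hex (m := a) ?_ ⟨g, hg, ha, ha'⟩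
  by_contra h
  exact ha (hgd a (not_lt.1 h))

lemma MonicOf.isLI1 {f : SkewPoly Θ} {d : ℕ} (hf : MonicOf f d) (hfC : f ∈ minReps C) :
    ∃ g₀ g₁, IsLI1 C g₀ g₁ := by
  obtain ⟨g₀, g₁, h₀, h₁, rfl⟩ := exists_decomp f
  exact ⟨g₀, g₁, h₀, h₁, Or.inr ⟨hfC, hf.isMonic⟩⟩

theorem Admissible.classification [Finite F] (H : Admissible Θ n lam)
    (hlam : lam = 1 ∨ lam = -1) :
    (∃ g₀ g₁, IsLI1 C g₀ g₁) ∨ (∃ g₁, IsLI2 C g₁) ∨ (∃ g₁ f₀ f₁, IsLI3 C g₁ f₀ f₁) := by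
  classical
  by_cases hC : C = ⊥
  · exact Or.inl ⟨modulus Θ n lam, 0, overField_modulus hlam, fun _ => rfl,
      Or.inl ⟨hC, by rw [mul_zero, add_zero]⟩⟩
  by_cases hmin : ∃ f ∈ minReps C, IsMonic f
  · obtain ⟨f, hf, hm⟩ := hmin
    exact Or.inl (hm.monicOf.isLI1 hf)
  refine Or.inr ?_
  push Not at hmin
  obtain ⟨d, hdn, hd, c, hcC, hcd, hcd'⟩ := H.exists_noneBelow hC
  -- A leading coefficient outside uF is a unit, and rescaling would give a monic element of minimal
  -- degree.
  have hfst : (cf c d).fst = 0 := by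
    by_contra h
    obtain ⟨t, ht⟩ := isUnit_of_fst_ne_zero h
    have hm : MonicOf (const Θ t * c) d := ⟨by rw [cf_const_mul, ht], hcd'.const_mul t⟩
    exact hmin _ (hd.mem_minReps hdn (mk_mul_mem _ hcC) hm.cf_ne_zero hm.degLT) hm.isMonic
  -- Multiplication by `u` kills the leading term, so minimality of `d` kills the product; hence `c`
  -- is a multiple of `u`.
  have huc : u Θ * c = 0 := by
    refine hd _ (mk_mul_mem _ hcC) fun i hi => ?_
    rw [cf_u_mul]
    obtain rfl | hi := hi.eq_or_lt
    · ext <;> simp [hfst]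
    · rw [hcd' i hi, mul_zero]
  obtain ⟨t, htF, rfl⟩ := exists_eq_u_mul_of_u_mul_eq_zero huc
  have ht0 : (cf t d).fst ≠ 0 := by
    intro h
    apply hcd
    rw [cf_u_mul]
    ext <;> simp [h]
  obtain ⟨g₁, hg₁⟩ : ∃ g, g = const Θ (TrivSqZeroExt.inl (cf t d).fst⁻¹) * t := ⟨_, rfl⟩
  have hgF : OverField g₁ := by
    rw [overField_iff_mem] at htF ⊢
    rw [hg₁, const_eq_mono]
    exact mul_mem (mono_mem_polyOver (inl_mem_fieldSubring _) _) htF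
  have hgu : u Θ * g₁ = const Θ (TrivSqZeroExt.inl (cf t d).fst⁻¹) * (u Θ * t) := by
    rw [hg₁, const_mul_u_mul]
  have hgC : mk Θ n lam (u Θ * g₁) ∈ C := by
    rw [hgu]
    exact mk_mul_mem _ hcC
  have hgd : cf (u Θ * g₁) d = ε := by
    have h : (TrivSqZeroExt.inl (cf t d).fst⁻¹ : F[ε]) * cf t d = 1 := by
      conv_lhs => enter [2]; rw [htF.cf_eq]
      rw [← TrivSqZeroExt.inl_mul, inv_mul_cancel₀ ht0, TrivSqZeroExt.inl_one]
    rw [cf_u_mul, hg₁, cf_const_mul, h, mul_one]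
  have hε : (ε : F[ε]) ≠ 0 := fun h =>
    one_ne_zero (α := F) (congrArg TrivSqZeroExt.snd h)
  have hgd' : DegLT (u Θ * g₁) (d + 1) := by
    rw [hgu]
    exact hcd'.const_mul _
  have hlead : leadingCoeff (u Θ * g₁) = ε := by
    rw [leadingCoeff_eq (hgd ▸ hε) hgd', hgd]
  have hgm : MonicOf g₁ d := monicOf_of_leadingCoeff_eq hgF (hgd ▸ hε) hgd' hlead
  have hgmin : u Θ * g₁ ∈ minReps C := hd.mem_minReps hdn hgC (hgd ▸ hε) hgd'
  by_cases hmon : ∃ f ∈ reps C, IsMonic f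
  · right
    have hex : ∃ e f, f ∈ reps C ∧ MonicOf f e := by
      obtain ⟨f, hf, hm⟩ := hmon
      exact ⟨_, f, hf, hm.monicOf⟩
    obtain ⟨f, hf, hfm⟩ := Nat.find_spec hex
    have hmin_e := fun e => Nat.find_min' hex (m := e)
    generalize Nat.find hex = e at hfm hmin_e
    obtain ⟨hfn, hfC⟩ := mem_reps.1 hf
    obtain ⟨f₀, b, h₀, hb, rfl⟩ := exists_decomp f
    -- This secures deg f₁ < deg g₁; the element stays monic of degree `e` because `d ≤ e`.
    obtain ⟨r, hr, hrd, hrC⟩ := exists_add_u_mul_mem hgm hgF hgC hb hfC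
    have hen : e < n := by
      by_contra h
      exact hfm.cf_ne_zero (hfn e (not_lt.1 h))
    have hde : d ≤ e := by
      by_contra h
      exact hfm.ne_zero (hd _ hfC (hfm.degLT.mono (by omega)))
    have hf₀ := hfm.left_of_add h₀
    have hm : MonicOf (f₀ + u Θ * r) e := by
      refine ⟨?_, hf₀.degLT.add (hrd.u_mul.mono (by omega))⟩
      rw [cf_add, hf₀.cf_eq, hrd.u_mul e hde, add_zero]
    refine ⟨g₁, f₀, r, hgF, h₀, hr, hmin, hgmin, hlead,
      mem_reps.2 ⟨hm.degLT.mono hen, hrC⟩, hm.isMonic, fun g hg hgmon => ?_, ?_⟩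
    · rw [hm.degree_eq, hgmon.monicOf.degree_eq]
      exact Nat.cast_le.2 (hmin_e _ ⟨g, hg, hgmon.monicOf⟩)
    · rw [hgm.degree_eq]
      exact degree_lt_iff.2 hrd
  · push Not at hmon
    exact Or.inl ⟨g₁, hgF, hmon, hgmin, hlead⟩

theorem Admissible.dual_of_isLI1 (H : Admissible Θ n lam) {g₀ g₁ : SkewPoly Θ}
    (hC : IsLI1 C g₀ g₁) :
    C = Ideal.span {mk Θ n lam (g₀ + u Θ * g₁)} ∧
      ∃ h P : SkewPoly Θ,
        h * (g₀ + u Θ * g₁) = modulus Θ n lam ∧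
        toLaurent P = xpow Θ ((n : ℤ) - natDegree g₀) * antiHom h ∧
        hermitianDual Θ (code C) = code (Ideal.span {mk Θ n lam (twist P)}) := by
  obtain ⟨d, hg, hdn, hd, hgC⟩ : ∃ d, MonicOf (g₀ + u Θ * g₁) d ∧ d ≤ n ∧ NoneBelow C d ∧
      mk Θ n lam (g₀ + u Θ * g₁) ∈ C := by
    obtain ⟨rfl, h⟩ | ⟨h, hm⟩ := hC.minimal
    -- The zero ideal fits the same argument with d = n and the modulus as its monic generator.
    · exact ⟨n, h ▸ H.monicOf_modulus, le_rfl, H.noneBelow_bot,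
        (congrArg (mk Θ n lam) h).trans H.mk_modulus⟩
    · obtain ⟨h1, h2⟩ := noneBelow_of_mem_minReps h hm.monicOf.cf_ne_zero hm.monicOf.degLT
      exact ⟨_, hm.monicOf, h1.le, h2, (mem_reps.1 h.1).2⟩
  have hspan := hd.eq_span hg hgC
  obtain ⟨h, hh⟩ := hd.exists_eq_mul hg hgC H.mk_modulus_mem
  refine ⟨hspan, h, reciprocal (n - d) h, hh.symm, ?_, ?_⟩
  · rw [(hg.left_of_add hC.overField_g₀).natDegree_eq]
    exact toLaurent_reciprocal_sub hdn (H.degLT_of_mul_eq_modulus hg hdn hh.symm)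
  · rw [H.hermitianDual_code, H.dualIdeal_of_monic hg hdn hh.symm hspan]

lemma exists_monicOf_of_mem_minReps {g₁ : SkewPoly Θ} (hgF : OverField g₁)
    (hmin : u Θ * g₁ ∈ minReps C) (hlead : leadingCoeff (u Θ * g₁) = ε) :
    ∃ d < n, MonicOf g₁ d ∧ NoneBelow C d ∧ mk Θ n lam (u Θ * g₁) ∈ C := by
  obtain ⟨d, h, h'⟩ := exists_degree hmin.2.1
  obtain ⟨hdn, hd⟩ := noneBelow_of_mem_minReps hmin h h'
  exact ⟨d, hdn, monicOf_of_leadingCoeff_eq hgF h h' hlead, hd, (mem_reps.1 hmin.1).2⟩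

theorem Admissible.dual_of_isLI2 [Finite F] (H : Admissible Θ n lam)
    (hlam : lam = 1 ∨ lam = -1) {g₁ : SkewPoly Θ} (hC : IsLI2 C g₁) :
    C = Ideal.span {mk Θ n lam (u Θ * g₁)} ∧
      ∃ h P : SkewPoly Θ,
        h * g₁ = modulus Θ n lam ∧
        toLaurent P = xpow Θ ((n : ℤ) - natDegree g₁) * antiHom h ∧
        hermitianDual Θ (code C) =
          code (Ideal.span {mk Θ n lam (u Θ), mk Θ n lam (twist P)}) := by
  have hgF := hC.overField_g₁
  obtain ⟨d, hdn, hg, hd, hgC⟩ :=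
    exists_monicOf_of_mem_minReps hgF hC.minimal hC.leadingCoeff_eq
  have hspan := hd.eq_span_u_mul H hg hgF hgC fun f e hf hfC => by
    by_contra he
    exact hC.not_monic f (mem_reps.2 ⟨hf.degLT.mono (by omega), hfC⟩) hf.isMonic
  -- The class of u π is zero, hence in `C`, so `g₁` right-divides π over F.
  obtain ⟨h, -, hh⟩ := hd.exists_eq_mul_of_u_mul hg hgF hgC (overField_modulus hlam)
    (mk_mul_mem _ H.mk_modulus_mem)
  refine ⟨hspan, h, reciprocal (n - d) h, hh.symm, ?_, ?_⟩
  · rw [hg.natDegree_eq]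
    exact toLaurent_reciprocal_sub hdn.le (H.degLT_of_mul_eq_modulus hg hdn.le hh.symm)
  · rw [H.hermitianDual_code, H.dualIdeal_of_u_mul hg hgF hdn.le hh.symm hspan]

theorem Admissible.dual_of_isLI3 [Finite F] (H : Admissible Θ n lam)
    (hlam : lam = 1 ∨ lam = -1) {g₁ f₀ f₁ : SkewPoly Θ} (hC : IsLI3 C g₁ f₀ f₁) :
    C = Ideal.span {mk Θ n lam (u Θ * g₁), mk Θ n lam (f₀ + u Θ * f₁)} ∧
      ∃ hf hg k m P Q : SkewPoly Θ,
        hf * f₀ = modulus Θ n lam ∧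
        hg * g₁ = modulus Θ n lam ∧
        OverField k ∧ hf * u Θ = u Θ * k ∧
        OverField m ∧ m * g₁ = k * f₁ ∧
        toLaurent P = xpow Θ ((n : ℤ) - natDegree f₀) * antiHom (hf * u Θ) ∧
        toLaurent Q = xpow Θ ((n : ℤ) - natDegree g₁) * antiHom (hg - u Θ * m) ∧
        hermitianDual Θ (code C) =
          code (Ideal.span {mk Θ n lam (twist P), mk Θ n lam (twist Q)}) := by
  have hgF := hC.overField_g₁
  have hf₀F := hC.overField_f₀
  have hπF : OverField (modulus Θ n lam) := overField_modulus hlam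
  obtain ⟨d, hdn, hg₁, hd, hgC⟩ :=
    exists_monicOf_of_mem_minReps hgF hC.minimal hC.leadingCoeff_eq
  obtain ⟨e, hf⟩ : ∃ e, MonicOf (f₀ + u Θ * f₁) e := ⟨_, hC.monic.monicOf⟩
  obtain ⟨hfn, hfC⟩ := mem_reps.1 hC.mem
  have hen : e < n := by
    by_contra h
    exact hf.cf_ne_zero (hfn e (not_lt.1 h))
  have hde : d ≤ e := by
    by_contra h
    exact hf.ne_zero (hd _ hfC (hf.degLT.mono (by omega)))
  have hf₀ := hf.left_of_add hf₀F
  have hf₁ : DegLT f₁ d := by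
    have := hC.degree_lt
    rw [hg₁.degree_eq] at this
    exact degree_lt_iff.1 this
  have hmin : ∀ g a, MonicOf g a → mk Θ n lam g ∈ C → e ≤ a := by
    intro g a hg hgC
    by_contra ha
    have := hC.minimal_monic g (mem_reps.2 ⟨hg.degLT.mono (by omega), hgC⟩) hg.isMonic
    rw [hf.degree_eq, hg.degree_eq] at this
    exact ha (Nat.cast_le.1 this)
  have hspan := hd.eq_span_pair hg₁ hgF hgC hf hfC hmin
  obtain ⟨hg, -, hhg⟩ := hd.exists_eq_mul_of_u_mul hg₁ hgF hgC hπF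
    (mk_mul_mem _ H.mk_modulus_mem)
  -- Division gives π = q (f₀ + u f₁) + p u g₁. Multiplying by `u` leaves u π = u q₀ f₀ with q₀ the
  -- F-part of `q`, and `u` cancels over F.
  obtain ⟨hf', hhf⟩ : ∃ h, h * f₀ = modulus Θ n lam := by
    obtain ⟨q, r, h, hr⟩ := hf.exists_div' (modulus Θ n lam)
    have hrC : mk Θ n lam r ∈ C := by
      rw [← sub_eq_of_eq_add' h]
      exact mk_sub_mem H.mk_modulus_mem (mk_mul_mem q hfC)
    obtain ⟨p, rfl⟩ := hd.exists_eq_mul_u_mul hg₁ hgF hgC hmin hrC hr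
    obtain ⟨q₀, q₁, hq₀, -, rfl⟩ := exists_decomp q
    have hq₀F : OverField (q₀ * f₀) := by
      rw [overField_iff_mem] at *
      exact mul_mem hq₀ hf₀F
    refine ⟨q₀, OverField.u_mul_cancel hq₀F hπF ?_⟩
    rw [h]
    simp only [mul_add, add_mul, u_mul_mul_u_mul, mul_assoc, u_mul_u_mul, add_zero]
  obtain ⟨k, hkF, hk, hkd⟩ := exists_mul_u_eq hf'
  have hfd : DegLT hf' (n - e + 1) := H.degLT_of_mul_eq_modulus hf₀ hen.le hhf
  have hkfF : OverField (k * f₁) := by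
    have hf₁F := hC.overField_f₁
    rw [overField_iff_mem] at *
    exact mul_mem hkF hf₁F
  -- As u k = hf' u, this is hf' (f₀ + u f₁) − π; membership provides the quotient `m`.
  have hkfC : mk Θ n lam (u Θ * (k * f₁)) ∈ C := by
    have h1 : u Θ * (k * f₁) = hf' * (f₀ + u Θ * f₁) - modulus Θ n lam := by
      rw [mul_add, hhf, add_sub_cancel_left, ← mul_assoc, ← hk, mul_assoc]
    rw [h1]
    exact mk_sub_mem (mk_mul_mem _ hfC) H.mk_modulus_mem
  obtain ⟨m, hmF, hm⟩ := hd.exists_eq_mul_of_u_mul hg₁ hgF hgC hkfF hkfC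
  obtain ⟨p, -, hp⟩ := hd.exists_eq_mul_of_u_mul hg₁ hgF hgC hf₀F (by
    have := mk_mul_mem (u Θ) hfC
    rwa [mul_add, u_mul_u_mul, add_zero] at this)
  -- Here deg k ≤ n − e and deg f₁ < d. With d ≤ e, this keeps `hg - u Θ * m` within degree n − d,
  -- so its reciprocal is a genuine polynomial.
  have hmd : DegLT m (n - e) := hg₁.degLT_of_mul (hm ▸ (hkd _ hfd).mul hf₁)
  have hQ : DegLT (hg - u Θ * m) (n - d + 1) :=
    (H.degLT_of_mul_eq_modulus hg₁ hdn.le hhg.symm).sub (hmd.u_mul.mono (by omega))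
  have hP : DegLT (hf' * u Θ) (n - e + 1) := by
    rw [hk]
    exact (hkd _ hfd).u_mul
  refine ⟨hspan, hf', hg, k, m, reciprocal (n - e) (hf' * u Θ),
    reciprocal (n - d) (hg - u Θ * m), hhf, hhg.symm, hkF, hk, overField_iff_mem.2 hmF, hm.symm,
    ?_, ?_, ?_⟩
  · rw [hf₀.natDegree_eq]
    exact toLaurent_reciprocal_sub hen.le hP
  · rw [hg₁.natDegree_eq]
    exact toLaurent_reciprocal_sub hdn.le hQ
  · rw [H.hermitianDual_code,
      H.dualIdeal_of_pair hg₁ hgF hf₀ hhf hhg.symm hk hm.symm hp hQ hP hspan]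

end Types

end SkewConstacyclic

end

open SkewConstacyclic

/-- In each case `h`, `hf`, `hg` are the (unique) right quotients of `x ^ n - lam` by the monic
skew polynomials `g₀ + u g₁`, `f₀`, `g₁`; `P` and `Q` are the (unique) skew polynomials equal to
the stated elements of the localization at the powers of `x`; and `k` is the skew polynomial over
the field with `hf * u = u * k`. -/
theorem theorem4p7 {F : Type*} [Field F] [Finite F] (Θ : RingAut F[ε]) (hΘ : orderOf Θ = 2)
    (n : ℕ) (hn : 0 < n) (hdvd : orderOf Θ ∣ n) (lam : F[ε]) (hlam : lam = 1 ∨ lam = -1)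
    (C : Ideal (SkewQuot Θ n lam)) :
    (∃ D : Ideal (SkewQuot Θ n lam), hermitianDual Θ (code C) = code D) ∧
    ((∃ g₀ g₁, IsLI1 C g₀ g₁) ∨ (∃ g₁, IsLI2 C g₁) ∨ (∃ g₁ f₀ f₁, IsLI3 C g₁ f₀ f₁)) ∧
    (∀ g₀ g₁ : SkewPoly Θ, IsLI1 C g₀ g₁ →
      C = Ideal.span {mk Θ n lam (g₀ + u Θ * g₁)} ∧
      ∃ h P : SkewPoly Θ,
        h * (g₀ + u Θ * g₁) = modulus Θ n lam ∧
        toLaurent P = xpow Θ ((n : ℤ) - natDegree g₀) * antiHom h ∧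
        hermitianDual Θ (code C) = code (Ideal.span {mk Θ n lam (twist P)})) ∧
    (∀ g₁ : SkewPoly Θ, IsLI2 C g₁ →
      C = Ideal.span {mk Θ n lam (u Θ * g₁)} ∧
      ∃ h P : SkewPoly Θ,
        h * g₁ = modulus Θ n lam ∧
        toLaurent P = xpow Θ ((n : ℤ) - natDegree g₁) * antiHom h ∧
        hermitianDual Θ (code C) =
          code (Ideal.span {mk Θ n lam (u Θ), mk Θ n lam (twist P)})) ∧
    (∀ g₁ f₀ f₁ : SkewPoly Θ, IsLI3 C g₁ f₀ f₁ →
      C = Ideal.span {mk Θ n lam (u Θ * g₁), mk Θ n lam (f₀ + u Θ * f₁)} ∧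
      ∃ hf hg k m P Q : SkewPoly Θ,
        hf * f₀ = modulus Θ n lam ∧
        hg * g₁ = modulus Θ n lam ∧
        OverField k ∧ hf * u Θ = u Θ * k ∧
        OverField m ∧ m * g₁ = k * f₁ ∧
        toLaurent P = xpow Θ ((n : ℤ) - natDegree f₀) * antiHom (hf * u Θ) ∧
        toLaurent Q = xpow Θ ((n : ℤ) - natDegree g₁) * antiHom (hg - u Θ * m) ∧
        hermitianDual Θ (code C) =
          code (Ideal.span {mk Θ n lam (twist P), mk Θ n lam (twist Q)})) := by
  have H := admissible hΘ hn hdvd hlam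
  exact ⟨⟨H.dualIdeal C, H.hermitianDual_code C⟩, H.classification hlam,
    fun _ _ h => H.dual_of_isLI1 h, fun _ h => H.dual_of_isLI2 hlam h,
    fun _ _ _ h => H.dual_of_isLI3 hlam h⟩
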